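/- Let $d\ge 1$ and let $\xi:\mathbb R^d\to[0,\infty]$ be continuous and spherically symmetric, with $\xi(0)=0$ and $C:=\int_{\mathbb R^d}e^{-\xi(x)}\,dx<\infty$ (here $e^{-\infty}=0$). Assume that for every $x$ the periodized sum $\sum_{y\in\mathbb Z^d}e^{-\xi(x-Ly)}$ converges to $e^{-\xi(x)}$ as $L\to\infty$ (in particular it is finite for $L$ large). Assume that the Fourier transform of $e^{-\xi}$ is nonnegative, and define the dispersion relation $\varepsilon:\mathbb R^d\to[0,\infty]$ by $$C\,e^{-\varepsilon(k)}=\int_{\mathbb R^d}e^{-2\pi i k\cdot x}\,e^{-\xi(x)}\,dx .$$ Let $$\rho_{\rm c}=\int_{\mathbb R^d}\frac{dk}{e^{\varepsilon(k)}-1}\in[0,\infty].$$ If $d\le 2$ and $\rho_{\rm c}<\infty$, assume moreover that there are $\delta>0$ and a nondecreasing $\psi:(0,\delta)\to[0,\infty]$ such that $\varepsilon(k)\ge\psi(|k|)$ for $0<|k|<\delta$ and $\int_{|k|<\delta}dk/\psi(|k|)<\infty$. Let $\Lambda$ be the cube of side length $L$ and volume $V=L^d$, let $\Lambda^*=(\frac1L\mathbb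 Z)^d$, and for $N\in\mathbb N$ let $\mathcal N_{\Lambda,N}$ be the set of families $\boldsymbol n=(n_k)_{k\in\Lambda^*}$ of nonnegative integers with $\sum_k n_k=N$. For $\boldsymbol n\in\mathcal N_{\Lambda,N}$ put $$P_{\Lambda,N}(\boldsymbol n)=\frac{1}{Z'(\Lambda,N)}\,e^{-\sum_{k}\varepsilon(k)n_k},\qquad Z'(\Lambda,N)=\sum_{\boldsymbol n\in\mathcal N_{\Lambda,N}}e^{-\sum_{k}\varepsilon(k)n_k},$$ with the convention $\infty\cdot 0=0$. Then for all sufficiently large $L$ and all $N$ this is a probability measure on $\mathcal N_{\Lambda,N}$, with expectation denoted $E_{\Lambda,N}$, and for every density $\rho\ge 0$ and every $\lambda\ge 0$, with $\rho_0=\max(0,\rho-\rho_{\rm c})$ (so $\rho_0=0$ if $\rho_{\rm c}=\infty$), $$\lim_{V\to\infty}E_{\Lambda,\lfloor\rho V\rfloor}\bigl(e^{\lambda n_0/V}\bigr)=e^{\lambda\rho_0}.$$ -/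

import Mathlib

open Filter Topology MeasureTheory
open scoped ENNReal NNReal FourierTransform

/-- `e^{-x}` for `x ∈ [0, ∞]`, with `e^{-∞} = 0`. -/
noncomputable def expNeg (x : ℝ≥0∞) : ℝ≥0∞ := EReal.exp (-(x : EReal))

/-- The integer point `z ∈ ℤ^d`, as a vector of Euclidean space `ℝ^d`. -/
noncomputable def latticeVec {d : ℕ} (z : Fin d → ℤ) : EuclideanSpace ℝ (Fin d) :=
  WithLp.toLp 2 (fun i => (z i : ℝ))

/-- The function `e^{-ξ_Λ(x)} = ∑_{y ∈ ℤ^d} e^{-ξ(x - L y)}`, as a sum in `[0, ∞]`. -/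
noncomputable def expNegPeriodized {d : ℕ} (ξ : EuclideanSpace ℝ (Fin d) → ℝ≥0∞) (L : ℝ)
    (x : EuclideanSpace ℝ (Fin d)) : ℝ≥0∞ :=
  ∑' y : Fin d → ℤ, expNeg (ξ (x - L • latticeVec y))

/-- `ε` is the dispersion relation of the one-body potential `ξ`: the Fourier transform of
`e^{-ξ}` is `C e^{-ε}`, where `C = ∫ e^{-ξ}`. Since `ε` takes values in `[0, ∞]`, this contains
the nonnegativity of the Fourier transform; `ε k = ∞` where the Fourier transform vanishes.
The bound `0 ≤ ε` is no restriction, because the Fourier transform is at most `C`. -/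
def IsDispersionRelation {d : ℕ} (ξ ε : EuclideanSpace ℝ (Fin d) → ℝ≥0∞) : Prop :=
  ∀ k : EuclideanSpace ℝ (Fin d),
    𝓕 (fun x : EuclideanSpace ℝ (Fin d) => (((expNeg (ξ x)).toReal : ℝ) : ℂ)) k
      = (((∫ x, (expNeg (ξ x)).toReal) * (expNeg (ε k)).toReal : ℝ) : ℂ)

/-- The critical density `ρ_c = ∫ dk / (e^{ε(k)} - 1)`, an element of `[0, ∞]`. -/
noncomputable def criticalDensity {d : ℕ} (ε : EuclideanSpace ℝ (Fin d) → ℝ≥0∞) : ℝ≥0∞ :=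
  ∫⁻ k, (EReal.exp (ε k : EReal) - 1)⁻¹

/-- `ρ_0 = max(0, ρ - ρ_c)`: the subtraction on `[0, ∞]` is truncated at `0`, and the result is
`0` when `ρ_c = ∞`. -/
noncomputable def condensateDensity {d : ℕ} (ε : EuclideanSpace ℝ (Fin d) → ℝ≥0∞) (ρ : ℝ≥0) : ℝ :=
  ((ρ : ℝ≥0∞) - criticalDensity ε).toReal

/-- The set of occupation numbers with total number `N`. The modes `k ∈ Λ^* = (L⁻¹ ℤ)^d` are
indexed by `z ∈ ℤ^d` through `k = L⁻¹ z`. -/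
def OccupationNumbers (d N : ℕ) : Type :=
  {n : (Fin d → ℤ) →₀ ℕ // (n.sum fun _ m => m) = N}

/-- The unnormalised weight `exp(-∑_k ε(k) n_k)` (with `∞ * 0 = 0`). -/
noncomputable def occWeight {d N : ℕ} (ε : EuclideanSpace ℝ (Fin d) → ℝ≥0∞) (L : ℝ)
    (n : OccupationNumbers d N) : ℝ≥0∞ :=
  expNeg (n.1.sum fun z m => ε (L⁻¹ • latticeVec z) * (m : ℝ≥0∞))

/-- The partition function `Z'(Λ, N)`, with `Λ` the cube of size `L`. -/
noncomputable def occPartition {d : ℕ} (ε : EuclideanSpace ℝ (Fin d) → ℝ≥0∞) (L : ℝ) (N : ℕ) :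
    ℝ≥0∞ :=
  ∑' n : OccupationNumbers d N, occWeight ε L n

/-- The probability `P_{Λ,N}(n) = exp(-∑_k ε(k) n_k) / Z'(Λ, N)`. -/
noncomputable def occProb {d N : ℕ} (ε : EuclideanSpace ℝ (Fin d) → ℝ≥0∞) (L : ℝ)
    (n : OccupationNumbers d N) : ℝ≥0∞ :=
  occWeight ε L n / occPartition ε L N

/-- The expectation `E_{Λ,N}(θ)` of a nonnegative random variable `θ` on occupation numbers. -/
noncomputable def occExpect {d : ℕ} (ε : EuclideanSpace ℝ (Fin d) → ℝ≥0∞) (L : ℝ) (N : ℕ)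
    (θ : OccupationNumbers d N → ℝ≥0∞) : ℝ≥0∞ :=
  ∑' n : OccupationNumbers d N, occProb ε L n * θ n

/-- The dispersion relation has a radially nondecreasing lower bound near the origin whose
inverse is integrable there: `ε(k) ≥ ψ(|k|)` for small `k ≠ 0`, and `∫_{|k| < δ} dk / ψ(|k|) < ∞`.
In dimension `d ≥ 3` the bound `ε(k) ≥ a |k|^2` is of this kind. -/
def HasIntegrableRadialLowerBound {d : ℕ} (ε : EuclideanSpace ℝ (Fin d) → ℝ≥0∞) : Prop :=
  ∃ δ : ℝ, 0 < δ ∧ ∃ ψ : ℝ → ℝ≥0∞, MonotoneOn ψ (Set.Ioo 0 δ) ∧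
    (∀ k : EuclideanSpace ℝ (Fin d), 0 < ‖k‖ → ‖k‖ < δ → ψ ‖k‖ ≤ ε k) ∧
    (∫⁻ k in Metric.ball (0 : EuclideanSpace ℝ (Fin d)) δ, (ψ ‖k‖)⁻¹) < ∞

/-!
Since `∫ e^{-ξ} = C`, the zero mode has energy `ε(0) = 0`, so it has weight one whatever its
occupation number. Hence `n₀ = N - X`, where `X` is the number of particles in the other modes, and
`X` has the law of a random variable with weights `W m` (`excitedWeight`) conditioned on `X ≤ N`
(`tsum_occWeight_mul`, `occExpect_eq`). Two facts about `W` carry the probabilistic part. First,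
`m W m = ∑ j, s j * W (m - j)`, with `s j` the sum of the `j`-th powers of the Boltzmann factors of
the nonzero modes: this is Newton's identity (`mul_canonicalSum`). Without the condition `X ≤ N`,
it gives `X` the mean `∑ j, s j`, a Riemann sum for `V ρ_c`, and the variance `∑ j, j * s j`
(`hasSum_sub_sq_mul`). Secondly, the partition functions `Z'(Λ, N)`, which are the partial sums of
`W`, are log-concave in `N` (`isLogConcave_canonicalSum`), so that `P(n₀ ≥ J)` decays at least
geometrically in `J`.

If `ρ ≤ ρ_c` and `n₀ ≥ δ V` had probability at least `η`, the geometric decay would make `n₀ ≥ j₀`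
almost certain for each fixed `j₀`. The mean of `X` is then at least about `∑_{j ≤ j₀} s j`, which
exceeds `c V` for any prescribed `c < ρ_c` once `j₀` is large. Thus `X` alone would nearly exhaust
the `ρ V` particles, leaving no room for a mean `δ η V` of `n₀` (`tendsto_zeroModeExp_one`). This
direction needs only the lower bound that Fatou's lemma gives for Riemann sums.

If `ρ > ρ_c`, Chebyshev's inequality applies to the unconditioned `X`, and the condition `X ≤ N`
costs nothing in the limit (`tendsto_zeroModeExp_of_lt`). What has to be shown is that the Riemann
sums of `(e^ε - 1)⁻¹` over `Λ^* \ {0}` converge to `ρ_c`, and that the variance is `o(V²)`; the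
latter holds because no single nonzero mode has a mean occupation of order `V`. Near the origin the
Riemann sums are dominated by a radially nonincreasing integrable function: the hypothesis on `ψ`
when `d ≤ 2`, and a multiple of `|k|⁻²` when `d ≥ 3` (`exists_sq_le_one_sub`). Away from the origin
they are dominated by a multiple of the Riemann sums of `e^{-ε}`, and these converge to
`∫ e^{-ε} = 1 / C`, which suffices for dominated convergence (`RiemannControl`,
`tendsto_lintegral_of_tendsto_lintegral_bound`).

The convergence of the Riemann sums of `e^{-ε}` is where the periodized potential enters. One
inequality of the Poisson summation formula, obtained by regularizing with periodized Gaussians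
(`sum_dual_lattice_le`), bounds these sums by `e^{-ξ_Λ(0)} / C`, which tends to `1 / C`. It also
shows that the partition functions are finite for large `L`.
-/

open Finset.HasAntidiagonal (antidiagonal)

/-! ### Sums over occupation numbers -/

/-- The sum over all families `n` of nonnegative integers with total `N` of the product of the
weights `a i (n i)`; the weights are meant to satisfy `a i 0 = 1`. -/
noncomputable def canonicalSum {ι : Type*} (a : ι → ℕ → ℝ≥0∞) (N : ℕ) : ℝ≥0∞ :=
  ∑' n : {n : ι →₀ ℕ // (n.sum fun _ m => m) = N}, n.1.prod a

/-- The contribution to `canonicalSum a N` of the families supported in a finite set of modes: it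
is a coefficient of the product of the generating functions of the modes. -/
noncomputable def finiteCanonicalSum {ι : Type*} (a : ι → ℕ → ℝ≥0∞) (A : Finset ι) (N : ℕ) :
    ℝ≥0∞ :=
  PowerSeries.coeff N (∏ i ∈ A, PowerSeries.mk (a i))

section Canonical

variable {ι : Type*}

theorem mem_finsuppAntidiag_iff_sum [DecidableEq ι] {A : Finset ι} {N : ℕ} {n : ι →₀ ℕ} :
    n ∈ A.finsuppAntidiag N ↔ (n.sum fun _ m => m) = N ∧ n.support ⊆ A := by
  rw [Finset.mem_finsuppAntidiag]
  constructor
  · rintro ⟨h1, h2⟩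
    exact ⟨by rw [← h1]; exact Finsupp.sum_of_support_subset _ h2 _ (fun _ _ => rfl), h2⟩
  · rintro ⟨h1, h2⟩
    exact ⟨by rw [← h1]; exact (Finsupp.sum_of_support_subset _ h2 (fun _ m => m)
      (fun _ _ => rfl)).symm, h2⟩

theorem tendsto_finiteCanonicalSum (a : ι → ℕ → ℝ≥0∞) (ha : ∀ i, a i 0 = 1) (N : ℕ) :
    Tendsto (fun A => finiteCanonicalSum a A N) atTop (𝓝 (canonicalSum a N)) := by
  classical
  let S : Finset ι → Finset {n : ι →₀ ℕ // (n.sum fun _ m => m) = N} := fun A =>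
    (A.finsuppAntidiag N).subtype _
  have hS : Tendsto S atTop atTop := by
    refine tendsto_atTop_finset_of_monotone ?_ ?_
    · intro A B hAB n hn
      simp only [S, Finset.mem_subtype] at hn ⊢
      exact Finset.finsuppAntidiag_mono hAB N hn
    · intro n
      refine ⟨n.1.support, ?_⟩
      simp only [S, Finset.mem_subtype, mem_finsuppAntidiag_iff_sum]
      exact ⟨n.2, subset_rfl⟩
  have h : HasSum (fun n : {n : ι →₀ ℕ // (n.sum fun _ m => m) = N} => n.1.prod a)
      (canonicalSum a N) := ENNReal.summable.hasSum
  refine (h.comp hS).congr fun A => ?_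
  simp only [Function.comp, finiteCanonicalSum, PowerSeries.coeff_prod, PowerSeries.coeff_mk, S]
  rw [Finset.sum_subtype_of_mem (p := fun n : ι →₀ ℕ => (n.sum fun _ m => m) = N)
    (fun n : ι →₀ ℕ => n.prod a)
    (fun n hn => (mem_finsuppAntidiag_iff_sum.1 hn).1)]
  refine Finset.sum_congr rfl fun n hn => ?_
  exact Finsupp.prod_of_support_subset _ (mem_finsuppAntidiag_iff_sum.1 hn).2 _ (fun i _ => ha i)

theorem finiteCanonicalSum_insert [DecidableEq ι] (a : ι → ℕ → ℝ≥0∞) {A : Finset ι} {i : ι}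
    (hi : i ∉ A) (N : ℕ) :
    finiteCanonicalSum a (insert i A) N
      = ∑ p ∈ antidiagonal N, a i p.1 * finiteCanonicalSum a A p.2 := by
  simp [finiteCanonicalSum, Finset.prod_insert hi, PowerSeries.coeff_mul]

/-- Separating one mode `i`: removing it amounts to letting its weights vanish on positive
occupation numbers. -/
theorem canonicalSum_eq_sum_antidiagonal (a b : ι → ℕ → ℝ≥0∞) (ha : ∀ i, a i 0 = 1)
    (hb : ∀ i, b i 0 = 1) (i : ι) (hfin : ∀ m, a i m ≠ ∞) (hi : ∀ m, m ≠ 0 → b i m = 0)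
    (hab : ∀ j, j ≠ i → a j = b j)
    (N : ℕ) :
    canonicalSum a N = ∑ p ∈ antidiagonal N, a i p.1 * canonicalSum b p.2 := by
  classical
  refine tendsto_nhds_unique (tendsto_finiteCanonicalSum a ha N) ?_
  have h : Tendsto (fun A => ∑ p ∈ antidiagonal N, a i p.1 * finiteCanonicalSum b A p.2) atTop
      (𝓝 (∑ p ∈ antidiagonal N, a i p.1 * canonicalSum b p.2)) :=
    tendsto_finsetSum _ fun p _ =>
      ENNReal.Tendsto.const_mul (tendsto_finiteCanonicalSum b hb p.2) (Or.inr (hfin p.1))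
  refine h.congr' ?_
  filter_upwards [eventually_ge_atTop {i}] with A hA
  have hiA : i ∈ A := Finset.singleton_subset_iff.1 hA
  rw [← Finset.insert_erase hiA, finiteCanonicalSum_insert a (Finset.notMem_erase i A)]
  have hone : PowerSeries.mk (b i) = 1 := by
    ext n
    by_cases hn : n = 0
    · simp [hn, hb]
    · simp [PowerSeries.coeff_one, hn, hi n hn]
  refine Finset.sum_congr rfl fun p _ => ?_
  congr 1
  unfold finiteCanonicalSum
  rw [Finset.prod_insert (Finset.notMem_erase i A), hone, one_mul]
  congr 1
  exact Finset.prod_congr rfl fun j hj => by rw [hab j (Finset.ne_of_mem_erase hj)]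

theorem geometric_eq (x : ℝ≥0∞) :
    PowerSeries.mk (fun n => x ^ n)
      = 1 + PowerSeries.C x * (PowerSeries.X * PowerSeries.mk (fun n => x ^ n)) := by
  ext n
  cases n with
  | zero => simp
  | succ n => simp [PowerSeries.coeff_succ_X_mul, PowerSeries.coeff_one, pow_succ']

theorem finiteCanonicalSum_pow_insert_succ [DecidableEq ι] (x : ι → ℝ≥0∞) {A : Finset ι} {i : ι}
    (hi : i ∉ A) (N : ℕ) :
    finiteCanonicalSum (fun i n => x i ^ n) (insert i A) (N + 1)
      = finiteCanonicalSum (fun i n => x i ^ n) A (N + 1)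
        + x i * finiteCanonicalSum (fun i n => x i ^ n) (insert i A) N := by
  simp only [finiteCanonicalSum, Finset.prod_insert hi]
  conv_lhs => rw [geometric_eq]
  rw [add_mul, one_mul, map_add, mul_assoc, mul_assoc, PowerSeries.coeff_C_mul,
    PowerSeries.coeff_succ_X_mul]

theorem finiteCanonicalSum_zero (a : ι → ℕ → ℝ≥0∞) (ha : ∀ i, a i 0 = 1) (A : Finset ι) :
    finiteCanonicalSum a A 0 = 1 := by
  simp [finiteCanonicalSum, map_prod, ha]

theorem finiteCanonicalSum_empty_succ (a : ι → ℕ → ℝ≥0∞) (N : ℕ) :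
    finiteCanonicalSum a ∅ (N + 1) = 0 := by
  simp [finiteCanonicalSum, PowerSeries.coeff_one]

theorem canonicalSum_zero (a : ι → ℕ → ℝ≥0∞) (ha : ∀ i, a i 0 = 1) : canonicalSum a 0 = 1 := by
  refine tendsto_nhds_unique (tendsto_finiteCanonicalSum a ha 0) ?_
  simp [finiteCanonicalSum_zero a ha]

theorem finiteCanonicalSum_le_pow (x : ι → ℝ≥0∞) (A : Finset ι) (N : ℕ) :
    finiteCanonicalSum (fun i n => x i ^ n) A N ≤ (∑ i ∈ A, x i) ^ N := by
  classical
  induction A using Finset.induction_on generalizing N with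
  | empty =>
    cases N with
    | zero => simp [finiteCanonicalSum_zero]
    | succ N => simp [finiteCanonicalSum_empty_succ]
  | insert i A hi ih =>
    induction N with
    | zero => simp [finiteCanonicalSum_zero]
    | succ N ihN =>
      rw [finiteCanonicalSum_pow_insert_succ x hi]
      calc _ ≤ (∑ j ∈ A, x j) ^ (N + 1) + x i * (∑ j ∈ insert i A, x j) ^ N := by
            gcongr; exact ih _
        _ ≤ (∑ j ∈ A, x j) * (∑ j ∈ insert i A, x j) ^ N + x i * (∑ j ∈ insert i A, x j) ^ N := by
            rw [pow_succ']
            gcongr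
            exact Finset.subset_insert _ _
        _ = _ := by rw [Finset.sum_insert hi]; ring

theorem canonicalSum_le_pow (x : ι → ℝ≥0∞) (N : ℕ) :
    canonicalSum (fun i n => x i ^ n) N ≤ (∑' i, x i) ^ N := by
  refine le_of_tendsto (tendsto_finiteCanonicalSum _ (by simp) N) (Eventually.of_forall fun A => ?_)
  exact (finiteCanonicalSum_le_pow x A N).trans (by gcongr; exact ENNReal.sum_le_tsum A)

theorem X_mul_derivative_geometric (x : ℝ≥0∞) :
    PowerSeries.X * PowerSeries.derivative ℝ≥0∞ (PowerSeries.mk (fun n => x ^ n))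
      = PowerSeries.mk (fun n => if n = 0 then 0 else x ^ n)
        * PowerSeries.mk (fun n => x ^ n) := by
  ext n
  cases n with
  | zero => simp
  | succ n =>
    rw [PowerSeries.coeff_succ_X_mul, PowerSeries.coeff_derivative, PowerSeries.coeff_mul,
      Finset.Nat.sum_antidiagonal_eq_sum_range_succ_mk, Finset.sum_range_succ']
    simp only [PowerSeries.coeff_mk, Nat.add_eq_zero_iff, one_ne_zero, and_false, if_false,
      if_true, zero_mul, add_zero]
    rw [Finset.sum_congr rfl (g := fun _ => x ^ (n + 1)) fun j hj => by
      rw [← pow_add]; congr 1; have := Finset.mem_range.1 hj; omega]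
    simp [mul_comm]

/-- The logarithmic derivative of the generating function of the canonical sums. -/
theorem X_mul_derivative_prod_geometric (x : ι → ℝ≥0∞) (A : Finset ι) :
    PowerSeries.X * PowerSeries.derivative ℝ≥0∞ (∏ i ∈ A, PowerSeries.mk (fun n => x i ^ n))
      = PowerSeries.mk (fun n => if n = 0 then 0 else ∑ i ∈ A, x i ^ n)
        * ∏ i ∈ A, PowerSeries.mk (fun n => x i ^ n) := by
  classical
  induction A using Finset.induction_on with
  | empty =>
    have : PowerSeries.mk (fun n : ℕ => if n = 0 then (0 : ℝ≥0∞) else ∑ i ∈ (∅ : Finset ι), x i ^ n)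
        = 0 := by ext n; simp
    rw [this]
    simp
  | insert i A hi ih =>
    have hadd : PowerSeries.mk (fun n : ℕ => if n = 0 then (0 : ℝ≥0∞) else ∑ j ∈ insert i A, x j ^ n)
        = PowerSeries.mk (fun n : ℕ => if n = 0 then (0 : ℝ≥0∞) else x i ^ n)
          + PowerSeries.mk (fun n : ℕ => if n = 0 then (0 : ℝ≥0∞) else ∑ j ∈ A, x j ^ n) := by
      ext n
      by_cases hn : n = 0
      · simp [hn]
      · simp [hn, Finset.sum_insert hi]
    rw [Finset.prod_insert hi, Derivation.leibniz, hadd, smul_eq_mul, smul_eq_mul, mul_add,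
      mul_left_comm, ih, mul_left_comm _ _ (PowerSeries.derivative _ _),
      X_mul_derivative_geometric]
    ring

/-- The Newton identity between the complete homogeneous sums and the power sums. -/
theorem mul_finiteCanonicalSum (x : ι → ℝ≥0∞) (A : Finset ι) (N : ℕ) :
    N * finiteCanonicalSum (fun i n => x i ^ n) A N
      = ∑ p ∈ antidiagonal N, (if p.1 = 0 then 0 else ∑ i ∈ A, x i ^ p.1)
          * finiteCanonicalSum (fun i n => x i ^ n) A p.2 := by
  have h := congrArg (PowerSeries.coeff N) (X_mul_derivative_prod_geometric x A)
  rw [PowerSeries.coeff_mul N (PowerSeries.mk _)] at h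
  simp only [PowerSeries.coeff_mk] at h
  unfold finiteCanonicalSum
  rw [← h]
  cases N with
  | zero => simp
  | succ N => rw [PowerSeries.coeff_succ_X_mul, PowerSeries.coeff_derivative, mul_comm]; simp

theorem canonicalSum_pow_ne_top (x : ι → ℝ≥0∞) (hx : ∑' i, x i ≠ ∞) (N : ℕ) :
    canonicalSum (fun i n => x i ^ n) N ≠ ∞ :=
  ne_top_of_le_ne_top (ENNReal.pow_ne_top hx) (canonicalSum_le_pow x N)

/-- Newton's identity for infinitely many modes. -/
theorem mul_canonicalSum (x : ι → ℝ≥0∞) (hx : ∑' i, x i ≠ ∞) (hx1 : ∀ i, x i ≤ 1) (N : ℕ) :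
    N * canonicalSum (fun i n => x i ^ n) N
      = ∑ p ∈ antidiagonal N, (if p.1 = 0 then 0 else ∑' i, x i ^ p.1)
          * canonicalSum (fun i n => x i ^ n) p.2 := by
  have hN := tendsto_finiteCanonicalSum (fun i n => x i ^ n) (by simp)
  refine tendsto_nhds_unique
    (ENNReal.Tendsto.const_mul (hN N) (Or.inr (ENNReal.natCast_ne_top N))) ?_
  simp_rw [mul_finiteCanonicalSum]
  refine tendsto_finsetSum _ fun p _ => ?_
  refine ENNReal.Tendsto.mul ?_ (Or.inr (canonicalSum_pow_ne_top x hx _)) (hN _) (Or.inr ?_)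
  · by_cases h : p.1 = 0
    · simp [h]
    · simp only [h, if_false]
      exact ENNReal.summable.hasSum
  · by_cases h : p.1 = 0
    · simp [h]
    · simp only [h, if_false]
      exact ne_top_of_le_ne_top hx (ENNReal.tsum_le_tsum fun i => pow_le_of_le_one zero_le
        (hx1 i) h)

/-- Log-concavity of a sequence without internal zeros, in a form free of division. -/
def IsLogConcave (h : ℕ → ℝ≥0∞) : Prop :=
  ∀ a p q, h a * h (a + p + q) ≤ h (a + p) * h (a + q)

/-- It suffices to compare the two products when one index moves by one. -/
theorem isLogConcave_of_adjacent {h : ℕ → ℝ≥0∞}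
    (H : ∀ i j, i ≤ j → h i * h (j + 1) ≤ h (i + 1) * h j) : IsLogConcave h := by
  have key : ∀ p a q, p ≤ q → h a * h (a + p + q) ≤ h (a + p) * h (a + q) := by
    intro p
    induction p with
    | zero => intro a q _; simp
    | succ p ih =>
      intro a q hq
      obtain ⟨q, rfl⟩ : ∃ r, q = r + 1 := ⟨q - 1, by omega⟩
      calc h a * h (a + (p + 1) + (q + 1)) = h a * h ((a + p + q + 1) + 1) := by
            congr 2; omega
        _ ≤ h (a + 1) * h (a + p + q + 1) := H _ _ (by omega)
        _ = h (a + 1) * h (a + 1 + p + q) := by congr 2; omega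
        _ ≤ h (a + 1 + p) * h (a + 1 + q) := ih _ _ (by omega)
        _ = _ := by congr 2 <;> omega
  intro a p q
  rcases le_total p q with hpq | hpq
  · exact key p a q hpq
  · rw [mul_comm (h (a + p)), add_right_comm]
    exact key q a p hpq

/-- Induction on the modes: adding a mode convolves the sequence with a geometric one, and the
defining inequality for neighbouring indices reduces term by term to the one for the old
sequence. -/
theorem isLogConcave_finiteCanonicalSum (x : ι → ℝ≥0∞) (A : Finset ι) :
    IsLogConcave (finiteCanonicalSum (fun i n => x i ^ n) A) := by
  classical
  induction A using Finset.induction_on with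
  | empty =>
    refine isLogConcave_of_adjacent fun i j _ => ?_
    simp [finiteCanonicalSum_empty_succ]
  | insert k A hk ih =>
    refine isLogConcave_of_adjacent fun i j hij => ?_
    rw [finiteCanonicalSum_pow_insert_succ x hk i, finiteCanonicalSum_pow_insert_succ x hk j,
      mul_add, add_mul]
    refine add_le_add ?_ (le_of_eq (by ring))
    rw [finiteCanonicalSum_insert _ hk, finiteCanonicalSum_insert _ hk,
      Finset.Nat.sum_antidiagonal_eq_sum_range_succ_mk,
      Finset.Nat.sum_antidiagonal_eq_sum_range_succ_mk, Finset.sum_mul, Finset.mul_sum]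
    refine (Finset.sum_le_sum fun l hl => ?_).trans
      (Finset.sum_le_sum_of_subset (Finset.range_mono (by omega : i + 1 ≤ j + 1)))
    have hl' : l ≤ i := by have := Finset.mem_range.1 hl; omega
    have := ih (i - l) (l + 1) (j - i)
    rw [show i - l + (l + 1) + (j - i) = j + 1 by omega, show i - l + (l + 1) = i + 1 by omega,
      show i - l + (j - i) = j - l by omega] at this
    simp only
    rw [mul_assoc, mul_left_comm (finiteCanonicalSum _ A (i + 1))]
    exact mul_le_mul_right this _

theorem isLogConcave_canonicalSum (x : ι → ℝ≥0∞) (hx : ∑' i, x i ≠ ∞) :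
    IsLogConcave (canonicalSum (fun i n => x i ^ n)) := by
  intro a p q
  have hN := tendsto_finiteCanonicalSum (fun i n => x i ^ n) (by simp)
  have hfin := canonicalSum_pow_ne_top x hx
  exact le_of_tendsto_of_tendsto'
    (ENNReal.Tendsto.mul (hN _) (Or.inr (hfin _)) (hN _) (Or.inr (hfin _)))
    (ENNReal.Tendsto.mul (hN _) (Or.inr (hfin _)) (hN _) (Or.inr (hfin _)))
    fun A => isLogConcave_finiteCanonicalSum x A a p q

end Canonical

/-! ### A nonnegative function with nonnegative Fourier transform -/

/-- `f` is a continuous integrable nonnegative function with `f 0 = 1`, and its Fourier transform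
is `(∫ f) • g` with `g` nonnegative. -/
structure IsNonnegFourierPair {V : Type*} [NormedAddCommGroup V] [InnerProductSpace ℝ V]
    [FiniteDimensional ℝ V] [MeasurableSpace V] [BorelSpace V] (f g : V → ℝ) : Prop where
  continuous : Continuous f
  nonneg : ∀ x, 0 ≤ f x
  integrable : Integrable f
  apply_zero : f 0 = 1
  nonneg' : ∀ k, 0 ≤ g k
  fourier : ∀ k, 𝓕 (fun x => (f x : ℂ)) k = (((∫ x, f x) * g k : ℝ) : ℂ)

namespace IsNonnegFourierPair

variable {V : Type*} [NormedAddCommGroup V] [InnerProductSpace ℝ V]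
    [FiniteDimensional ℝ V] [MeasurableSpace V] [BorelSpace V] {f g : V → ℝ}

theorem integral_pos (h : IsNonnegFourierPair f g) : 0 < ∫ x, f x := by
  rw [integral_pos_iff_support_of_nonneg h.nonneg h.integrable]
  exact (h.continuous.isOpen_support).measure_pos _ ⟨0, by simp [h.apply_zero]⟩

theorem mul_eq_integral_cos (h : IsNonnegFourierPair f g) (k : V) :
    (∫ x, f x) * g k = ∫ x, f x * Real.cos (2 * Real.pi * inner ℝ x k) := by
  have h1 := congrArg Complex.re (h.fourier k)
  rw [Complex.ofReal_re, Real.fourier_eq'] at h1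
  rw [← h1]
  have hint : Integrable (fun v : V =>
      Complex.exp (↑(-2 * Real.pi * inner ℝ v k) * Complex.I) • (f v : ℂ)) := by
    refine (h.integrable.ofReal (𝕜 := ℂ)).bdd_mul (c := 1) (by fun_prop)
      (Eventually.of_forall fun v => ?_)
    rw [Complex.norm_exp_ofReal_mul_I]
  have h2 := integral_re hint
  simp only [RCLike.re_to_complex] at h2
  rw [← h2]
  refine integral_congr_ae (Eventually.of_forall fun v => ?_)
  simp only [smul_eq_mul, Complex.re_mul_ofReal, Complex.exp_ofReal_mul_I_re]
  rw [mul_comm, ← Real.cos_neg]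
  congr 2
  ring

theorem integrable_mul_cos (h : IsNonnegFourierPair f g) (k : V) :
    Integrable (fun x => f x * Real.cos (2 * Real.pi * inner ℝ x k)) :=
  h.integrable.mul_bdd (c := 1) (by fun_prop) (Eventually.of_forall fun v => Real.abs_cos_le_one _)

theorem mul_one_sub_eq (h : IsNonnegFourierPair f g) (k : V) :
    (∫ x, f x) * (1 - g k) = ∫ x, f x * (1 - Real.cos (2 * Real.pi * inner ℝ x k)) := by
  simp_rw [mul_sub, mul_one]
  rw [integral_sub h.integrable (h.integrable_mul_cos k), h.mul_eq_integral_cos]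

theorem integrable_mul_one_sub (h : IsNonnegFourierPair f g) (k : V) :
    Integrable (fun x => f x * (1 - Real.cos (2 * Real.pi * inner ℝ x k))) := by
  simp_rw [mul_sub, mul_one]
  exact h.integrable.sub (h.integrable_mul_cos k)

theorem apply_zero' (h : IsNonnegFourierPair f g) : g 0 = 1 := by
  have := h.mul_one_sub_eq 0
  simp only [inner_zero_right, mul_zero, Real.cos_zero, sub_self, integral_zero] at this
  have := (mul_eq_zero.1 this).resolve_left h.integral_pos.ne'
  linarith

theorem le_one (h : IsNonnegFourierPair f g) (k : V) : g k ≤ 1 := by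
  have : 0 ≤ (∫ x, f x) * (1 - g k) := by
    rw [h.mul_one_sub_eq]
    exact integral_nonneg fun x => mul_nonneg (h.nonneg x)
      (by linarith [Real.cos_le_one (2 * Real.pi * inner ℝ x k)])
  linarith [nonneg_of_mul_nonneg_right this h.integral_pos]

/-- `g k = 1` would force `cos (2π ⟪x, k⟫) = 1` wherever `f x > 0`, in particular for all small
`x`. -/
theorem lt_one (h : IsNonnegFourierPair f g) {k : V} (hk : k ≠ 0) : g k < 1 := by
  refine lt_of_le_of_ne (h.le_one k) fun hgk => ?_
  have h0 := h.mul_one_sub_eq k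
  rw [hgk, sub_self, mul_zero] at h0
  have hnn : ∀ x, 0 ≤ f x * (1 - Real.cos (2 * Real.pi * inner ℝ x k)) := fun x =>
    mul_nonneg (h.nonneg x) (by linarith [Real.cos_le_one (2 * Real.pi * inner ℝ x k)])
  have hae := (integral_eq_zero_iff_of_nonneg hnn (h.integrable_mul_one_sub k)).1 h0.symm
  have hc : Continuous (fun x => f x * (1 - Real.cos (2 * Real.pi * inner ℝ x k))) :=
    h.continuous.mul (by fun_prop)
  have heq := (hc.ae_eq_iff_eq volume continuous_const).1 hae
  have hk2 : 0 < ‖k‖ ^ 2 := by positivity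
  have hev : ∀ᶠ t : ℝ in 𝓝[>] 0, 0 < f (t • k) ∧ 0 < t ∧ t * ‖k‖ ^ 2 < 1 := by
    have h1 : ∀ᶠ t : ℝ in 𝓝 0, 0 < f (t • k) := by
      have : Tendsto (fun t : ℝ => f (t • k)) (𝓝 0) (𝓝 1) := by
        have := (h.continuous.comp (by fun_prop : Continuous fun t : ℝ => t • k)).tendsto 0
        simpa [h.apply_zero, Function.comp_def] using this
      exact this.eventually_const_lt one_pos
    have h2 : ∀ᶠ t : ℝ in 𝓝 0, t * ‖k‖ ^ 2 < 1 := by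
      have : Tendsto (fun t : ℝ => t * ‖k‖ ^ 2) (𝓝 0) (𝓝 0) := by
        have := (by fun_prop : Continuous fun t : ℝ => t * ‖k‖ ^ 2).tendsto 0
        simpa using this
      exact this.eventually_lt_const one_pos
    filter_upwards [h1.filter_mono nhdsWithin_le_nhds, h2.filter_mono nhdsWithin_le_nhds,
      self_mem_nhdsWithin] with t a b c using ⟨a, c, b⟩
  obtain ⟨t, ht1, ht2, ht3⟩ := hev.exists
  have : f (t • k) * (1 - Real.cos (2 * Real.pi * inner ℝ (t • k) k)) = 0 := congrFun heq (t • k)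
  simp only [mul_eq_zero, ht1.ne', false_or] at this
  rw [real_inner_smul_left, real_inner_self_eq_norm_sq] at this
  have hcos : Real.cos (2 * Real.pi * (t * ‖k‖ ^ 2)) = 1 := by linarith
  have hpos : 0 < 2 * Real.pi * (t * ‖k‖ ^ 2) := by positivity
  rw [Real.cos_eq_one_iff_of_lt_of_lt (by nlinarith [Real.pi_pos])
    (by nlinarith [Real.pi_pos])] at hcos
  exact hpos.ne' hcos

theorem continuous' (h : IsNonnegFourierPair f g) : Continuous g := by
  have h1 : Continuous (𝓕 (fun x => (f x : ℂ))) :=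
    VectorFourier.fourierIntegral_continuous Real.continuous_fourierChar
      (by exact continuous_inner) h.integrable.ofReal
  have h2 : g = fun k => (∫ x, f x)⁻¹ * (𝓕 (fun x => (f x : ℂ)) k).re := by
    ext k
    rw [h.fourier, Complex.ofReal_re, inv_mul_cancel_left₀ h.integral_pos.ne']
  rw [h2]
  fun_prop

theorem tendsto_cocompact (h : IsNonnegFourierPair f g) : Tendsto g (cocompact V) (𝓝 0) := by
  have h1 := tendsto_integral_exp_inner_smul_cocompact (fun x : V => (f x : ℂ))
  have h2 : g = fun k => (∫ x, f x)⁻¹ * (∫ v, Real.fourierChar (-inner ℝ v k) • (f v : ℂ)).re := by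
    ext k
    rw [← Real.fourier_eq, h.fourier, Complex.ofReal_re, inv_mul_cancel_left₀ h.integral_pos.ne']
  rw [h2]
  simpa using ((Complex.continuous_re.tendsto _).comp h1).const_mul (∫ x, f x)⁻¹

/-- The doubling inequality, from `1 - cos (2t) ≤ 4 (1 - cos t)`. -/
theorem one_sub_two_smul_le (h : IsNonnegFourierPair f g) (k : V) :
    1 - g ((2 : ℝ) • k) ≤ 4 * (1 - g k) := by
  have hle : (∫ x, f x) * (1 - g ((2 : ℝ) • k)) ≤ (∫ x, f x) * (4 * (1 - g k)) := by
    rw [h.mul_one_sub_eq, mul_left_comm, h.mul_one_sub_eq, ← integral_const_mul]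
    refine integral_mono (h.integrable_mul_one_sub _)
      ((h.integrable_mul_one_sub _).const_mul 4) fun x => ?_
    simp only [inner_smul_right]
    rw [show 2 * Real.pi * (2 * inner ℝ x k) = 2 * (2 * Real.pi * inner ℝ x k) by ring,
      Real.cos_two_mul,
      mul_left_comm]
    refine mul_le_mul_of_nonneg_left ?_ (h.nonneg x)
    nlinarith [sq_nonneg (1 - Real.cos (2 * Real.pi * inner ℝ x k))]
  exact le_of_mul_le_mul_left hle h.integral_pos

/-- The quadratic lower bound on the dispersion relation near the origin: the doubling inequality
propagates a positive lower bound on the annulus `1 / 2 ≤ ‖k‖ ≤ 1` to the punctured unit ball. -/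
theorem exists_sq_le_one_sub (h : IsNonnegFourierPair f g) :
    ∃ a : ℝ, 0 < a ∧ ∀ k : V, ‖k‖ ≤ 1 → a * ‖k‖ ^ 2 ≤ 1 - g k := by
  obtain ⟨a, ha, hak⟩ : ∃ a : ℝ, 0 < a ∧ ∀ k : V, 1 / 2 ≤ ‖k‖ → ‖k‖ ≤ 1 → a ≤ 1 - g k := by
    have hcomp : IsCompact (Metric.closedBall (0 : V) 1 ∩ {k | 1 / 2 ≤ ‖k‖}) :=
      (isCompact_closedBall _ _).inter_right (isClosed_le continuous_const continuous_norm)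
    rcases (Metric.closedBall (0 : V) 1 ∩ {k | 1 / 2 ≤ ‖k‖}).eq_empty_or_nonempty with he | hne
    · refine ⟨1, one_pos, fun k hk1 hk2 => ?_⟩
      have : k ∈ (Metric.closedBall (0 : V) 1 ∩ {k | 1 / 2 ≤ ‖k‖}) := ⟨by simpa using hk2, hk1⟩
      rw [he] at this
      exact this.elim
    · obtain ⟨k0, hk0, hmin⟩ := hcomp.exists_isMinOn hne
        (continuous_const.sub h.continuous' : Continuous fun k => 1 - g k).continuousOn
      refine ⟨1 - g k0, ?_, fun k hk1 hk2 => hmin ⟨by simpa using hk2, hk1⟩⟩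
      have : k0 ≠ 0 := by
        rintro rfl
        have := hk0.2
        simp at this
        linarith
      linarith [h.lt_one this]
  have key : ∀ n : ℕ, ∀ k : V, 1 / 2 ^ (n + 1) ≤ ‖k‖ → ‖k‖ ≤ 1 → a * ‖k‖ ^ 2 ≤ 1 - g k := by
    intro n
    induction n with
    | zero =>
      intro k hk1 hk2
      refine le_trans ?_ (hak k (by simpa using hk1) hk2)
      have : ‖k‖ ^ 2 ≤ 1 := pow_le_one₀ (norm_nonneg k) hk2
      nlinarith
    | succ n ih =>
      intro k hk1 hk2
      rcases le_or_gt (1 / 2) ‖k‖ with hh | hh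
      · refine le_trans ?_ (hak k hh hk2)
        have : ‖k‖ ^ 2 ≤ 1 := pow_le_one₀ (norm_nonneg k) hk2
        nlinarith
      · have hn : ‖(2 : ℝ) • k‖ = 2 * ‖k‖ := by rw [norm_smul]; simp
        have := ih ((2 : ℝ) • k) (by rw [hn]; rw [pow_succ, one_div, mul_inv] at hk1; rw [one_div]; linarith)
          (by rw [hn]; linarith)
        rw [hn] at this
        nlinarith [h.one_sub_two_smul_le k]
  refine ⟨a, ha, fun k hk => ?_⟩
  by_cases hk0 : k = 0
  · simp [hk0, h.apply_zero']
  · obtain ⟨n, hn⟩ := exists_pow_lt_of_lt_one (norm_pos_iff.2 hk0) (by norm_num : (1 / 2 : ℝ) < 1)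
    refine key n k ?_ hk
    rw [one_div, ← inv_pow, ← one_div, pow_succ]
    have : (0 : ℝ) < (1 / 2) ^ n := by positivity
    linarith

/-- Gaussian regularization: the Fourier transform, being nonnegative, is integrable because its
Gaussian means converge to `f 0`. -/
theorem integrable' (h : IsNonnegFourierPair f g) : Integrable g := by
  have hf : Integrable (fun x => (f x : ℂ)) := h.integrable.ofReal
  have h1 := Real.tendsto_integral_gaussian_smul' hf (v := 0)
    (Complex.continuous_ofReal.comp h.continuous).continuousAt
  have h2 : Tendsto (fun c : ℝ => ∫ w : V, Real.exp (-c⁻¹ * ‖w‖ ^ 2) * ((∫ x, f x) * g w)) atTop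
      (𝓝 1) := by
    have h3 := (Complex.continuous_re.tendsto _).comp h1
    rw [h.apply_zero] at h3
    refine h3.congr' ?_
    filter_upwards [Ioi_mem_atTop 0] with c (hc : 0 < c)
    have J : Integrable (fun w : V ↦ Complex.exp (- (c : ℂ)⁻¹ * ‖w‖ ^ 2 + 2 * Real.pi * Complex.I * (inner ℝ (0 : V) w : ℝ))) :=
      GaussianFourier.integrable_cexp_neg_mul_sq_norm_add (by simpa) _ _
    have h4 := VectorFourier.integral_fourierIntegral_smul_eq_flip (L := innerₗ V)
      Real.continuous_fourierChar continuous_inner J hf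
    have h5 : ∀ w, VectorFourier.fourierIntegral Real.fourierChar volume (innerₗ V)
        (fun w : V ↦ Complex.exp (- (c : ℂ)⁻¹ * ‖w‖ ^ 2 + 2 * Real.pi * Complex.I * (inner ℝ (0 : V) w : ℝ))) w
        = (Real.pi * c : ℂ) ^ (Module.finrank ℝ V / 2 : ℂ) * Complex.exp (-Real.pi ^ 2 * c * ‖0 - w‖ ^ 2) := by
      intro w
      have := fourier_gaussian_innerProductSpace' (V := V) (b := (c : ℂ)⁻¹) (by simpa) 0 w
      refine this.trans ?_
      congr 2
      · simp
      · field_simp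
    have h6 : ∀ w, VectorFourier.fourierIntegral Real.fourierChar volume (innerₗ V).flip
        (fun x => (f x : ℂ)) w = (((∫ x, f x) * g w : ℝ) : ℂ) := by
      intro w
      rw [flip_innerₗ]
      exact h.fourier w
    simp_rw [h5, h6] at h4
    simp only [Function.comp]
    rw [h4]
    rw [← Complex.ofReal_re (∫ w : V, _ * _), ← integral_complex_ofReal]
    congr 2
    ext w
    simp
  have hm : AEStronglyMeasurable g volume := h.continuous'.aestronglyMeasurable
  suffices H : Integrable (fun k => (∫ x, f x) * g k) by
    simpa [inv_mul_cancel_left₀ h.integral_pos.ne'] using H.const_mul (∫ x, f x)⁻¹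
  refine ⟨hm.const_mul _, ?_⟩
  have hnn : ∀ k, 0 ≤ (∫ x, f x) * g k := fun k => mul_nonneg h.integral_pos.le (h.nonneg' k)
  rw [hasFiniteIntegral_iff_ofReal (Eventually.of_forall hnn)]
  have hlim : ∀ k : V, Tendsto (fun c : ℝ => ENNReal.ofReal (Real.exp (-c⁻¹ * ‖k‖ ^ 2) * ((∫ x, f x) * g k)))
      atTop (𝓝 (ENNReal.ofReal ((∫ x, f x) * g k))) := by
    intro k
    refine ENNReal.tendsto_ofReal ?_
    have : Tendsto (fun c : ℝ => Real.exp (-c⁻¹ * ‖k‖ ^ 2)) atTop (𝓝 1) := by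
      have h7 : Tendsto (fun c : ℝ => -c⁻¹ * ‖k‖ ^ 2) atTop (𝓝 0) := by
        simpa using (tendsto_inv_atTop_zero.neg.mul_const (‖k‖ ^ 2) : Tendsto (fun c : ℝ => -c⁻¹ * ‖k‖ ^ 2) atTop _)
      simpa [Function.comp_def] using (Real.continuous_exp.tendsto 0).comp h7
    simpa using this.mul_const ((∫ x, f x) * g k)
  calc ∫⁻ k, ENNReal.ofReal ((∫ x, f x) * g k)
      = ∫⁻ k, liminf (fun c : ℝ => ENNReal.ofReal (Real.exp (-c⁻¹ * ‖k‖ ^ 2) * ((∫ x, f x) * g k))) atTop :=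
        lintegral_congr fun k => (hlim k).liminf_eq.symm
    _ ≤ liminf (fun c : ℝ => ∫⁻ k, ENNReal.ofReal (Real.exp (-c⁻¹ * ‖k‖ ^ 2) * ((∫ x, f x) * g k))) atTop :=
        lintegral_liminf_le fun c => by
          have := h.continuous'.measurable
          fun_prop
    _ = 1 := by
        have h8 := ENNReal.tendsto_ofReal h2
        rw [ENNReal.ofReal_one] at h8
        refine (h8.congr' ?_).liminf_eq
        filter_upwards [Ioi_mem_atTop 0] with c (hc : 0 < c)
        rw [ofReal_integral_eq_lintegral_ofReal]
        · have J : Integrable (fun w : V ↦ Real.exp (- c⁻¹ * ‖w‖ ^ 2)) := by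
            have := GaussianFourier.integrable_cexp_neg_mul_sq_norm_add (V := V) (b := (c : ℂ)⁻¹)
              (by simpa) 0 0
            have := this.re
            refine this.congr (Eventually.of_forall fun w => ?_)
            simp only [RCLike.re_to_complex]
            rw [← Complex.ofReal_re (Real.exp _)]
            congr 1
            push_cast
            simp
          refine J.mul_bdd (c := ∫ x, f x) (hm.const_mul _) (Eventually.of_forall fun k => ?_)
          rw [Real.norm_of_nonneg (hnn k)]
          exact mul_le_of_le_one_right h.integral_pos.le (h.le_one k)
        · exact Eventually.of_forall fun k => mul_nonneg (Real.exp_pos _).le (hnn k)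
    _ < ∞ := ENNReal.one_lt_top

/-- Fourier inversion. -/
theorem integral_exp_mul (h : IsNonnegFourierPair f g) (x : V) :
    ∫ k, Complex.exp (↑(2 * Real.pi * inner ℝ k x) * Complex.I) * (g k : ℂ)
      = ((f x / ∫ y, f y : ℝ) : ℂ) := by
  have hF : 𝓕 (fun x => (f x : ℂ)) = fun k => ((∫ y, f y : ℝ) : ℂ) * (g k : ℂ) := by
    ext k
    rw [h.fourier]
    simp
  have h1 := (h.integrable.ofReal (𝕜 := ℂ)).fourierInv_fourier_eq (v := x)
    (by
      have := h.integrable'.ofReal (𝕜 := ℂ)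
      refine (this.const_mul ((∫ y, f y : ℝ) : ℂ)).congr (Eventually.of_forall fun k => ?_)
      exact (congrFun hF k).symm)
    (Complex.continuous_ofReal.comp h.continuous).continuousAt
  have h2 : 𝓕⁻ (𝓕 (fun x => (f x : ℂ))) x = (f x : ℂ) := h1
  rw [Real.fourierInv_eq', hF] at h2
  simp only [smul_eq_mul] at h2
  simp_rw [mul_left_comm _ ((∫ y, f y : ℝ) : ℂ)] at h2
  rw [integral_const_mul] at h2
  have hne : ((∫ y, f y : ℝ) : ℂ) ≠ 0 := by exact_mod_cast h.integral_pos.ne'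
  rw [Complex.ofReal_div, eq_div_iff hne, mul_comm, h2]

theorem integral_mul_integral (h : IsNonnegFourierPair f g) : (∫ x, f x) * ∫ k, g k = 1 := by
  have h1 := h.integral_exp_mul 0
  simp only [inner_zero_right, mul_zero, Complex.ofReal_zero, zero_mul, Complex.exp_zero,
    one_mul, integral_complex_ofReal] at h1
  have h2 : ∫ k, g k = f 0 / ∫ y, f y := by exact_mod_cast h1
  rw [h2, h.apply_zero, mul_one_div_cancel h.integral_pos.ne']

end IsNonnegFourierPair

/-! ### One half of the Poisson summation formula -/

/-- The periodized Gaussian on `ℝ`, normalized so that its Fourier coefficients are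
`exp (-π a n²)`. -/
noncomputable def periodizedGaussian (a t : ℝ) : ℝ :=
  (√a)⁻¹ * ∑' n : ℤ, Real.exp (-(Real.pi / a) * (n - t) ^ 2)

theorem summable_exp_neg_mul_int_sub_sq {a : ℝ} (ha : 0 < a) (t : ℝ) :
    Summable fun n : ℤ => Real.exp (-(Real.pi / a) * (n - t) ^ 2) := by
  have h := (summable_jacobiTheta₂_term_iff (-(t / a : ℝ) * Complex.I) ((a⁻¹ : ℝ) * Complex.I)).2
    (by simpa using ha)
  have h2 := h.norm.mul_left (Real.exp (-(Real.pi / a) * t ^ 2))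
  refine h2.congr fun n => ?_
  rw [norm_jacobiTheta₂_term, ← Real.exp_add]
  congr 1
  simp
  field_simp
  ring

theorem summable_exp_neg_mul_int_sq {a : ℝ} (ha : 0 < a) :
    Summable fun n : ℤ => Real.exp (-Real.pi * a * n ^ 2) := by
  refine (summable_exp_neg_mul_int_sub_sq (inv_pos.2 ha) 0).congr fun n => ?_
  simp [mul_comm]

/-- The weighted character `exp (-π a n² + 2π i n t)`. -/
noncomputable def gaussianCharacter (a t : ℝ) (n : ℤ) : ℂ :=
  Complex.exp (-Real.pi * a * n ^ 2 + 2 * Real.pi * (t * n : ℝ) * Complex.I)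

theorem gaussianCharacter_eq (a t : ℝ) (n : ℤ) :
    gaussianCharacter a t n = (Real.exp (-Real.pi * a * n ^ 2) : ℂ)
      * Complex.exp ((2 * Real.pi * (t * n) : ℝ) * Complex.I) := by
  rw [gaussianCharacter, Complex.exp_add]
  push_cast
  rfl

theorem norm_gaussianCharacter (a t : ℝ) (n : ℤ) :
    ‖gaussianCharacter a t n‖ = Real.exp (-Real.pi * a * n ^ 2) := by
  rw [gaussianCharacter_eq, norm_mul, Complex.norm_exp_ofReal_mul_I, mul_one, Complex.norm_real,
    Real.norm_of_nonneg (Real.exp_pos _).le]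

theorem hasSum_gaussianCharacter {a : ℝ} (ha : 0 < a) (t : ℝ) :
    HasSum (gaussianCharacter a t) (periodizedGaussian a t) := by
  have hs : Summable (gaussianCharacter a t) := by
    refine Summable.of_norm ?_
    simp_rw [norm_gaussianCharacter]
    exact summable_exp_neg_mul_int_sq ha
  have h := Complex.tsum_exp_neg_quadratic (a := a) (by simpa using ha) (Complex.I * t)
  have h1 : ∀ n : ℤ, Complex.exp (-Real.pi * a * n ^ 2 + 2 * Real.pi * (Complex.I * t) * n)
      = gaussianCharacter a t n := by
    intro n
    rw [gaussianCharacter]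
    congr 1
    push_cast
    ring
  have h2 : ∀ n : ℤ, Complex.exp (-Real.pi / a * (n + Complex.I * (Complex.I * t)) ^ 2)
      = (Real.exp (-(Real.pi / a) * (n - t) ^ 2) : ℝ) := by
    intro n
    rw [← mul_assoc, Complex.I_mul_I]
    push_cast
    congr 1
    ring
  simp_rw [h1, h2] at h
  rw [hs.hasSum_iff, h, periodizedGaussian, ← Complex.ofReal_tsum, Real.sqrt_eq_rpow]
  rw [one_div, Complex.ofReal_mul, Complex.ofReal_inv, Complex.ofReal_cpow ha.le]
  norm_num

theorem sum_le_periodizedGaussian {a : ℝ} (ha : 0 < a) (t : ℝ) (S : Finset ℤ) :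
    ∑ n ∈ S, (√a)⁻¹ * Real.exp (-(Real.pi / a) * (n - t) ^ 2) ≤ periodizedGaussian a t := by
  rw [periodizedGaussian, ← Finset.mul_sum]
  gcongr
  exact (summable_exp_neg_mul_int_sub_sq ha t).sum_le_tsum S fun n _ => (Real.exp_pos _).le

theorem periodizedGaussian_nonneg (a t : ℝ) : 0 ≤ periodizedGaussian a t :=
  mul_nonneg (by positivity) (tsum_nonneg fun n => (Real.exp_pos _).le)

namespace IsNonnegFourierPair

variable {d : ℕ} {f g : EuclideanSpace ℝ (Fin d) → ℝ}

theorem integral_mul_prod_sum_gaussianCharacter (h : IsNonnegFourierPair f g) (L a : ℝ)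
    (S : Finset ℤ) :
    ∫ w : EuclideanSpace ℝ (Fin d),
        (g w : ℂ) * ∏ i, ∑ n ∈ S, gaussianCharacter a (L * w i) n
      = ((∑ z ∈ Fintype.piFinset fun _ : Fin d => S,
          (∏ i, Real.exp (-Real.pi * a * (z i) ^ 2)) * (f (L • latticeVec z) / ∫ x, f x) : ℝ) : ℂ) := by
  have h1 : ∀ w : EuclideanSpace ℝ (Fin d),
      (g w : ℂ) * ∏ i, ∑ n ∈ S, gaussianCharacter a (L * w i) n
      = ∑ z ∈ Fintype.piFinset fun _ : Fin d => S, ((∏ i, Real.exp (-Real.pi * a * (z i) ^ 2) : ℝ) : ℂ)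
        * (Complex.exp (↑(2 * Real.pi * inner ℝ w (L • latticeVec z)) * Complex.I) * (g w : ℂ)) := by
    intro w
    rw [Finset.prod_univ_sum, Finset.mul_sum]
    refine Finset.sum_congr rfl fun z _ => ?_
    simp_rw [gaussianCharacter_eq]
    rw [Finset.prod_mul_distrib, ← Complex.exp_sum, mul_left_comm, mul_comm (g w : ℂ)]
    congr 2
    · push_cast; rfl
    · congr 1
      rw [← Finset.sum_mul]
      congr 1
      rw [PiLp.inner_apply]
      simp only [latticeVec, PiLp.smul_apply, smul_eq_mul, RCLike.inner_apply, conj_trivial]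
      push_cast
      rw [Finset.mul_sum]
      refine Finset.sum_congr rfl fun i _ => ?_
      ring
  simp_rw [h1]
  rw [integral_finsetSum]
  · rw [Complex.ofReal_sum]
    refine Finset.sum_congr rfl fun z _ => ?_
    rw [integral_const_mul, h.integral_exp_mul, Complex.ofReal_mul]
  · intro z _
    refine Integrable.const_mul ?_ _
    refine ((h.integrable'.ofReal (𝕜 := ℂ)).bdd_mul (c := 1) (by fun_prop)
      (Eventually.of_forall fun v => ?_))
    rw [Complex.norm_exp_ofReal_mul_I]

/-- Each Fourier coefficient of the product of periodized Gaussians lies in `[0, 1]`, and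
integrating `g` against a character gives a value of `f / ∫ f` by Fourier inversion. -/
theorem integral_mul_prod_periodizedGaussian_le (h : IsNonnegFourierPair f g) (L : ℝ)
    (hs : Summable fun z : Fin d → ℤ => f (L • latticeVec z)) {a : ℝ} (ha : 0 < a) :
    Integrable (fun w => g w * ∏ i, periodizedGaussian a (L * w i)) ∧
    ∫ w : EuclideanSpace ℝ (Fin d), g w * ∏ i, periodizedGaussian a (L * w i)
      ≤ (∑' z : Fin d → ℤ, f (L • latticeVec z)) / ∫ x, f x := by
  have hgm := h.continuous'.measurable
  have hptw : ∀ w : EuclideanSpace ℝ (Fin d), Tendsto (fun S : Finset ℤ =>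
      (g w : ℂ) * ∏ i, ∑ n ∈ S, gaussianCharacter a (L * w i) n) atTop
      (𝓝 (g w * ∏ i, periodizedGaussian a (L * w i) : ℝ)) := by
    intro w
    push_cast
    exact tendsto_const_nhds.mul (tendsto_finsetProd _ fun i _ => hasSum_gaussianCharacter ha _)
  have hmeas : ∀ S : Finset ℤ, Continuous fun w : EuclideanSpace ℝ (Fin d) =>
      (g w : ℂ) * ∏ i, ∑ n ∈ S, gaussianCharacter a (L * w i) n := by
    intro S
    have := h.continuous'
    unfold gaussianCharacter
    fun_prop
  have hbound : ∀ (S : Finset ℤ) (w : EuclideanSpace ℝ (Fin d)),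
      ‖(g w : ℂ) * ∏ i, ∑ n ∈ S, gaussianCharacter a (L * w i) n‖
      ≤ g w * (∑' n : ℤ, Real.exp (-Real.pi * a * n ^ 2)) ^ d := by
    intro S w
    rw [norm_mul, Complex.norm_real, Real.norm_of_nonneg (h.nonneg' w), norm_prod]
    refine mul_le_mul_of_nonneg_left ?_ (h.nonneg' w)
    refine (Finset.prod_le_prod (g := fun _ => ∑' n : ℤ, Real.exp (-Real.pi * a * n ^ 2))
      (fun i _ => norm_nonneg _) fun i _ => ?_).trans_eq (by simp)
    refine (norm_sum_le _ _).trans ?_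
    simp_rw [norm_gaussianCharacter]
    exact (summable_exp_neg_mul_int_sq ha).sum_le_tsum S fun n _ => (Real.exp_pos _).le
  have hlim := tendsto_integral_filter_of_dominated_convergence (l := atTop)
    (F := fun (S : Finset ℤ) (w : EuclideanSpace ℝ (Fin d)) =>
      (g w : ℂ) * ∏ i, ∑ n ∈ S, gaussianCharacter a (L * w i) n)
    (fun w => g w * (∑' n : ℤ, Real.exp (-Real.pi * a * n ^ 2)) ^ d)
    (Eventually.of_forall fun S => (hmeas S).aestronglyMeasurable)
    (Eventually.of_forall fun S => Eventually.of_forall fun w => hbound S w)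
    (h.integrable'.mul_const _) (Eventually.of_forall hptw)
  have hnn : ∀ w : EuclideanSpace ℝ (Fin d), 0 ≤ g w * ∏ i, periodizedGaussian a (L * w i) :=
    fun w => mul_nonneg (h.nonneg' w) (Finset.prod_nonneg fun i _ => periodizedGaussian_nonneg _ _)
  constructor
  · have hm : AEStronglyMeasurable (fun w : EuclideanSpace ℝ (Fin d) =>
        ((g w * ∏ i, periodizedGaussian a (L * w i) : ℝ) : ℂ)) volume :=
      aestronglyMeasurable_of_tendsto_ae atTop (fun S => (hmeas S).aestronglyMeasurable)
        (Eventually.of_forall hptw)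
    refine (h.integrable'.mul_const ((∑' n : ℤ, Real.exp (-Real.pi * a * n ^ 2)) ^ d)).mono'
      (hm.re.congr (Eventually.of_forall fun w => Complex.ofReal_re _))
        (Eventually.of_forall fun w => ?_)
    have := le_of_tendsto (hptw w).norm (Eventually.of_forall fun S => hbound S w)
    rwa [Complex.norm_real] at this
  · rw [integral_complex_ofReal] at hlim
    have hlim2 := hlim.norm
    rw [Complex.norm_real, Real.norm_of_nonneg (integral_nonneg hnn)] at hlim2
    refine le_of_tendsto hlim2 (Eventually.of_forall fun S => ?_)
    rw [h.integral_mul_prod_sum_gaussianCharacter, Complex.norm_real]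
    have hC := h.integral_pos
    rw [Real.norm_of_nonneg (Finset.sum_nonneg fun z _ => mul_nonneg
      (Finset.prod_nonneg fun i _ => (Real.exp_pos _).le) (div_nonneg (h.nonneg _) hC.le))]
    calc _ ≤ ∑ z ∈ Fintype.piFinset fun _ : Fin d => S, f (L • latticeVec z) / ∫ x, f x := by
          refine Finset.sum_le_sum fun z _ => mul_le_of_le_one_left
            (div_nonneg (h.nonneg _) hC.le) ?_
          refine Finset.prod_le_one (fun i _ => (Real.exp_pos _).le) fun i _ => ?_
          rw [Real.exp_le_one_iff]
          have : 0 ≤ Real.pi * a * (z i : ℝ) ^ 2 := by have := Real.pi_pos; positivity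
          linarith
      _ = (∑ z ∈ Fintype.piFinset fun _ : Fin d => S, f (L • latticeVec z)) / ∫ x, f x := by
          rw [Finset.sum_div]
      _ ≤ _ := by
          gcongr
          exact hs.sum_le_tsum _ fun z _ => h.nonneg _

/-- The sum of the Fourier transform over the dual lattice is at most the sum of the function over
the lattice. Only this half of Poisson's formula is needed, and it holds without any decay. -/
theorem sum_dual_lattice_le (h : IsNonnegFourierPair f g) {L : ℝ} (hL : 0 < L)
    (hs : Summable fun z : Fin d → ℤ => f (L • latticeVec z)) (F : Finset (Fin d → ℤ)) :
    ∑ z ∈ F, g (L⁻¹ • latticeVec z) * (L ^ d)⁻¹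
      ≤ (∑' z : Fin d → ℤ, f (L • latticeVec z)) / ∫ x, f x := by
  have hlim : ∀ z : Fin d → ℤ, Tendsto (fun c : ℝ => ∫ w : EuclideanSpace ℝ (Fin d),
      (√(Real.pi * c)) ^ d * Real.exp (-Real.pi ^ 2 * c * ‖L⁻¹ • latticeVec z - w‖ ^ 2) * g w) atTop
      (𝓝 (g (L⁻¹ • latticeVec z))) := by
    intro z
    have h1 := Real.tendsto_integral_gaussian_smul' (h.integrable'.ofReal (𝕜 := ℂ))
      (v := L⁻¹ • latticeVec z) (Complex.continuous_ofReal.comp h.continuous').continuousAt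
    have h2 := (Complex.continuous_re.tendsto _).comp h1
    simp only [Complex.coe_algebraMap, Complex.ofReal_re] at h2
    refine h2.congr' ?_
    filter_upwards [Ioi_mem_atTop 0] with c (hc : 0 < c)
    simp only [Function.comp]
    rw [← Complex.ofReal_re (∫ w : EuclideanSpace ℝ (Fin d), _ * _), ← integral_complex_ofReal]
    congr 2
    ext w
    have hpc : 0 < Real.pi * c := by have := Real.pi_pos; positivity
    rw [smul_eq_mul, Real.sqrt_eq_rpow, ← Real.rpow_natCast, ← Real.rpow_mul hpc.le]
    rw [finrank_euclideanSpace_fin]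
    push_cast
    rw [Complex.ofReal_cpow hpc.le]
    push_cast
    congr 3
    ring
  have hsum : Tendsto (fun c : ℝ => ∑ z ∈ F, (∫ w : EuclideanSpace ℝ (Fin d),
      (√(Real.pi * c)) ^ d * Real.exp (-Real.pi ^ 2 * c * ‖L⁻¹ • latticeVec z - w‖ ^ 2) * g w) * (L ^ d)⁻¹) atTop
      (𝓝 (∑ z ∈ F, g (L⁻¹ • latticeVec z) * (L ^ d)⁻¹)) :=
    tendsto_finsetSum _ fun z _ => (hlim z).mul_const _
  refine le_of_tendsto hsum ?_
  filter_upwards [Ioi_mem_atTop 0] with c (hc : 0 < c)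
  have hpi := Real.pi_pos
  -- with this `a`, the Gaussian in `L w` centred at `z` is the one in `w` centred at `L⁻¹ z`
  set a : ℝ := L ^ 2 / (Real.pi * c) with ha_def
  have ha : 0 < a := by positivity
  obtain ⟨hint, hle⟩ := h.integral_mul_prod_periodizedGaussian_le L hs ha
  refine le_trans ?_ hle
  have hterm : ∀ (z : Fin d → ℤ) (w : EuclideanSpace ℝ (Fin d)),
      (√(Real.pi * c)) ^ d * Real.exp (-Real.pi ^ 2 * c * ‖L⁻¹ • latticeVec z - w‖ ^ 2) * g w * (L ^ d)⁻¹
      = g w * ∏ i, ((√a)⁻¹ * Real.exp (-(Real.pi / a) * (z i - L * w i) ^ 2)) := by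
    intro z w
    rw [Finset.prod_mul_distrib, ← Real.exp_sum, ← Finset.mul_sum]
    have hsq : (√a)⁻¹ = √(Real.pi * c) * L⁻¹ := by
      rw [ha_def, Real.sqrt_div (by positivity), Real.sqrt_sq hL.le, inv_div, div_eq_mul_inv]
    have hnorm : ‖L⁻¹ • latticeVec z - w‖ ^ 2 = (L ^ 2)⁻¹ * ∑ i, ((z i : ℝ) - L * w i) ^ 2 := by
      rw [EuclideanSpace.norm_sq_eq, Finset.mul_sum]
      refine Finset.sum_congr rfl fun i _ => ?_
      simp only [latticeVec, PiLp.sub_apply, PiLp.smul_apply, smul_eq_mul, Real.norm_eq_abs, sq_abs]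
      field_simp
    rw [hsq, hnorm, Finset.prod_const, Finset.card_univ, Fintype.card_fin, mul_pow]
    have hexp : -Real.pi ^ 2 * c * ((L ^ 2)⁻¹ * ∑ i, ((z i : ℝ) - L * w i) ^ 2)
        = -(Real.pi / a) * ∑ i, ((z i : ℝ) - L * w i) ^ 2 := by
      rw [ha_def]
      field_simp
    rw [hexp, inv_pow]
    ring
  have hI : ∀ z ∈ F, Integrable (fun w : EuclideanSpace ℝ (Fin d) =>
      g w * ∏ i, ((√a)⁻¹ * Real.exp (-(Real.pi / a) * (z i - L * w i) ^ 2))) := by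
    intro z _
    refine h.integrable'.mul_bdd (c := ∏ i : Fin d, (√a)⁻¹) (by fun_prop)
      (Eventually.of_forall fun w => ?_)
    rw [Real.norm_of_nonneg (Finset.prod_nonneg fun i _ => by positivity)]
    refine Finset.prod_le_prod (fun i _ => by positivity) fun i _ => ?_
    refine mul_le_of_le_one_right (by positivity) ?_
    rw [Real.exp_le_one_iff]
    have : 0 ≤ Real.pi / a * ((z i : ℝ) - L * w i) ^ 2 := by positivity
    linarith
  simp_rw [← integral_mul_const, hterm]
  rw [← integral_finsetSum _ hI]
  refine integral_mono (integrable_finsetSum _ hI) hint fun w => ?_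
  simp only
  rw [← Finset.mul_sum]
  refine mul_le_mul_of_nonneg_left ?_ (h.nonneg' w)
  classical
  let S : Finset ℤ := F.biUnion fun z => Finset.univ.image z
  calc _ ≤ ∑ z ∈ Fintype.piFinset fun _ : Fin d => S,
        ∏ i, ((√a)⁻¹ * Real.exp (-(Real.pi / a) * (z i - L * w i) ^ 2)) := by
        refine Finset.sum_le_sum_of_subset_of_nonneg (fun z hz => ?_)
          fun z _ _ => Finset.prod_nonneg fun i _ => by positivity
        rw [Fintype.mem_piFinset]
        intro i
        exact Finset.mem_biUnion.2 ⟨z, hz, Finset.mem_image_of_mem _ (Finset.mem_univ i)⟩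
    _ = ∏ i : Fin d, ∑ n ∈ S, ((√a)⁻¹ * Real.exp (-(Real.pi / a) * (n - L * w i) ^ 2)) := by
        rw [Finset.prod_univ_sum]
    _ ≤ _ := Finset.prod_le_prod (fun i _ => Finset.sum_nonneg fun n _ => by positivity)
        fun i _ => sum_le_periodizedGaussian ha _ S

end IsNonnegFourierPair

/-! ### Riemann sums over the dual lattice -/

section Cells

variable {d : ℕ}

/-- The index `z` of the half-open cell `∏ i, [z i / L, (z i + 1) / L)` that contains `y`. -/
noncomputable def cellIndex (L : ℝ) (y : EuclideanSpace ℝ (Fin d)) : Fin d → ℤ :=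
  fun i => ⌊L * y i⌋

theorem measurable_cellIndex (L : ℝ) : Measurable (cellIndex L : EuclideanSpace ℝ (Fin d) → _) :=
  measurable_pi_lambda _ fun i => Int.measurable_floor.comp (by fun_prop)

theorem volume_preimage_cellIndex {L : ℝ} (hL : 0 < L) (z : Fin d → ℤ) :
    volume (cellIndex L ⁻¹' {z} : Set (EuclideanSpace ℝ (Fin d)))
      = ENNReal.ofReal ((L ^ d)⁻¹) := by
  have h1 : (cellIndex L ⁻¹' {z} : Set (EuclideanSpace ℝ (Fin d)))
      = (MeasurableEquiv.toLp 2 (Fin d → ℝ)).symm ⁻¹'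
        (Set.univ.pi fun i => Set.Ico ((z i : ℝ) / L) ((z i + 1) / L)) := by
    ext y
    simp only [Set.mem_preimage, Set.mem_singleton_iff, cellIndex, funext_iff, Int.floor_eq_iff,
      Set.mem_univ_pi, Set.mem_Ico, div_le_iff₀' hL, lt_div_iff₀' hL]
    rfl
  rw [h1, (EuclideanSpace.volume_preserving_symm_measurableEquiv_toLp (Fin d)).measure_preimage
    (MeasurableSet.univ_pi fun i => measurableSet_Ico).nullMeasurableSet, Real.volume_pi_Ico]
  simp only [← sub_div, add_sub_cancel_left, Finset.prod_const, Finset.card_univ, Fintype.card_fin]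
  rw [← ENNReal.ofReal_pow (by positivity)]
  simp

theorem lintegral_comp_cellIndex {L : ℝ} (hL : 0 < L) (F : (Fin d → ℤ) → ℝ≥0∞) :
    ∫⁻ y : EuclideanSpace ℝ (Fin d), F (cellIndex L y)
      = (∑' z, F z) * ENNReal.ofReal ((L ^ d)⁻¹) := by
  rw [← lintegral_map (μ := (volume : Measure (EuclideanSpace ℝ (Fin d)))) (f := F)
    (measurable_of_countable F) (measurable_cellIndex L), lintegral_countable',
    ← ENNReal.tsum_mul_right]
  refine tsum_congr fun z => ?_
  rw [Measure.map_apply (measurable_cellIndex L) (measurableSet_singleton z),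
    volume_preimage_cellIndex hL]

theorem norm_sub_cellIndex_le {L : ℝ} (hL : 0 < L) (y : EuclideanSpace ℝ (Fin d)) :
    ‖y - L⁻¹ • latticeVec (cellIndex L y)‖ ≤ d / L := by
  rw [EuclideanSpace.norm_eq, Real.sqrt_le_iff]
  refine ⟨by positivity, ?_⟩
  have h1 : ∀ i, ‖(y - L⁻¹ • latticeVec (cellIndex L y)) i‖ ^ 2 ≤ (1 / L) ^ 2 := by
    intro i
    refine pow_le_pow_left₀ (norm_nonneg _) ?_ 2
    simp only [latticeVec, cellIndex, PiLp.sub_apply, PiLp.smul_apply, smul_eq_mul]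
    have h2 : y i - L⁻¹ * ⌊L * y i⌋ = Int.fract (L * y i) / L := by
      rw [Int.fract]; field_simp
    rw [h2, Real.norm_of_nonneg (div_nonneg (Int.fract_nonneg _) hL.le)]
    gcongr
    exact (Int.fract_lt_one _).le
  calc _ ≤ ∑ i : Fin d, (1 / L) ^ 2 := Finset.sum_le_sum fun i _ => h1 i
    _ = d * (1 / L) ^ 2 := by simp
    _ ≤ (d : ℝ) ^ 2 * (1 / L) ^ 2 := by
        gcongr
        exact_mod_cast Nat.le_self_pow two_ne_zero d
    _ = _ := by ring

theorem tendsto_cellIndex (y : EuclideanSpace ℝ (Fin d)) :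
    Tendsto (fun L : ℝ => L⁻¹ • latticeVec (cellIndex L y)) atTop (𝓝 y) := by
  rw [tendsto_iff_norm_sub_tendsto_zero]
  refine squeeze_zero' (g := fun L : ℝ => d / L) (Eventually.of_forall fun _ => norm_nonneg _) ?_
    (tendsto_const_nhds.div_atTop tendsto_id)
  filter_upwards [Ioi_mem_atTop 0] with L hL
  rw [norm_sub_rev]
  exact norm_sub_cellIndex_le hL y

theorem latticeVec_zero : latticeVec (0 : Fin d → ℤ) = 0 := by
  ext i; simp [latticeVec]

theorem one_le_norm_latticeVec {z : Fin d → ℤ} (hz : z ≠ 0) : 1 ≤ ‖latticeVec z‖ := by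
  obtain ⟨i, hi⟩ := Function.ne_iff.1 hz
  refine le_trans ?_ (PiLp.norm_apply_le (latticeVec z) i)
  simp only [latticeVec, Real.norm_eq_abs]
  exact_mod_cast Int.one_le_abs hi

theorem eventually_cellIndex_ne_zero {y : EuclideanSpace ℝ (Fin d)} (hy : y ≠ 0) :
    ∀ᶠ L : ℝ in atTop, cellIndex L y ≠ 0 := by
  filter_upwards [(tendsto_cellIndex y).eventually_ne hy] with L hL h
  rw [h, latticeVec_zero, smul_zero] at hL
  exact hL rfl

/-- In a cell other than the one of the origin, a point is at most `d + 1` times as far from the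
origin as the corner of the cell. -/
theorem inv_mul_norm_le {L : ℝ} (hL : 0 < L) {y : EuclideanSpace ℝ (Fin d)}
    (hy : cellIndex L y ≠ 0) :
    ((d : ℝ) + 1)⁻¹ * ‖y‖ ≤ ‖L⁻¹ • latticeVec (cellIndex L y)‖ := by
  rw [inv_mul_le_iff₀ (by positivity)]
  have h1 := norm_sub_cellIndex_le hL y
  have h2 : 1 / L ≤ ‖L⁻¹ • latticeVec (cellIndex L y)‖ := by
    rw [norm_smul, Real.norm_of_nonneg (by positivity), one_div]
    exact le_mul_of_one_le_right (by positivity) (one_le_norm_latticeVec hy)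
  have h3 : ‖y‖ ≤ ‖y - L⁻¹ • latticeVec (cellIndex L y)‖ + ‖L⁻¹ • latticeVec (cellIndex L y)‖ := by
    simpa using norm_add_le (y - L⁻¹ • latticeVec (cellIndex L y))
      (L⁻¹ • latticeVec (cellIndex L y))
  have h4 : (d : ℝ) / L ≤ d * ‖L⁻¹ • latticeVec (cellIndex L y)‖ := by
    rw [div_eq_mul_one_div]
    gcongr
  linarith

/-- The values of `F` at the nonzero points of the dual lattice. -/
noncomputable def nonzeroMode (F : EuclideanSpace ℝ (Fin d) → ℝ≥0∞) (L : ℝ) (z : Fin d → ℤ) :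
    ℝ≥0∞ :=
  if z = 0 then 0 else F (L⁻¹ • latticeVec z)

theorem tendsto_nonzeroMode {F : EuclideanSpace ℝ (Fin d) → ℝ≥0∞}
    {y : EuclideanSpace ℝ (Fin d)} (hy : y ≠ 0) (hF : ContinuousAt F y) :
    Tendsto (fun L => nonzeroMode F L (cellIndex L y)) atTop (𝓝 (F y)) := by
  refine (hF.tendsto.comp (tendsto_cellIndex y)).congr' ?_
  filter_upwards [eventually_cellIndex_ne_zero hy] with L hL
  simp [nonzeroMode, hL]

theorem ae_ne_zero (hd : 1 ≤ d) : ∀ᵐ y : EuclideanSpace ℝ (Fin d), y ≠ 0 := by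
  have : Nonempty (Fin d) := ⟨⟨0, hd⟩⟩
  exact Measure.ae_ne volume 0

/-- Fatou's lemma for Riemann sums; the term at the origin, where `F` may be singular, is left
out. -/
theorem lintegral_le_liminf_tsum (hd : 1 ≤ d) {F : EuclideanSpace ℝ (Fin d) → ℝ≥0∞}
    (hF : ∀ y, y ≠ 0 → ContinuousAt F y) :
    ∫⁻ y, F y ≤ liminf (fun L : ℝ => (∑' z, nonzeroMode F L z) * ENNReal.ofReal ((L ^ d)⁻¹))
      atTop := by
  have h1 : ∫⁻ y, F y = ∫⁻ y, liminf (fun L : ℝ => nonzeroMode F L (cellIndex L y)) atTop := by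
    refine lintegral_congr_ae ?_
    filter_upwards [ae_ne_zero hd] with y hy
    exact (tendsto_nonzeroMode hy (hF y hy)).liminf_eq.symm
  rw [h1]
  refine (lintegral_liminf_le fun L => (measurable_of_countable (nonzeroMode F L)).comp
    (measurable_cellIndex L)).trans_eq ?_
  refine liminf_congr ?_
  filter_upwards [Ioi_mem_atTop 0] with L hL
  exact lintegral_comp_cellIndex hL _

end Cells

/-- Dominated convergence with a convergent sequence of dominating functions. -/
theorem tendsto_lintegral_of_tendsto_lintegral_bound {α ι : Type*} [MeasurableSpace α]
    {μ : Measure α} {l : Filter ι} [l.IsCountablyGenerated] {f G : ι → α → ℝ≥0∞}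
    {f₀ G₀ : α → ℝ≥0∞} (hf : ∀ i, Measurable (f i)) (hG : ∀ i, Measurable (G i))
    (hf₀ : AEMeasurable f₀ μ)
    (hle : ∀ᶠ i in l, f i ≤ᵐ[μ] G i) (hlim : ∀ᵐ x ∂μ, Tendsto (fun i => f i x) l (𝓝 (f₀ x)))
    (hlimG : ∀ᵐ x ∂μ, Tendsto (fun i => G i x) l (𝓝 (G₀ x))) (hfin : ∫⁻ x, G₀ x ∂μ ≠ ∞)
    (hGm : AEMeasurable G₀ μ) (hle₀ : f₀ ≤ᵐ[μ] G₀)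
    (hint : Tendsto (fun i => ∫⁻ x, G i x ∂μ) l (𝓝 (∫⁻ x, G₀ x ∂μ))) :
    Tendsto (fun i => ∫⁻ x, f i x ∂μ) l (𝓝 (∫⁻ x, f₀ x ∂μ)) := by
  rcases l.eq_or_neBot with rfl | _
  · exact tendsto_bot
  have hlow : ∫⁻ x, f₀ x ∂μ ≤ liminf (fun i => ∫⁻ x, f i x ∂μ) l := by
    refine (lintegral_congr_ae ?_).trans_le (lintegral_liminf_le hf)
    filter_upwards [hlim] with x hx using hx.liminf_eq.symm
  -- Fatou's lemma for `G i - f i` gives the upper bound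
  have hlow2 : ∫⁻ x, (G₀ x - f₀ x) ∂μ ≤ liminf (fun i => ∫⁻ x, (G i x - f i x) ∂μ) l := by
    refine (lintegral_congr_ae ?_).trans_le (lintegral_liminf_le fun i => (hG i).sub (hf i))
    filter_upwards [hlim, hlimG, ae_lt_top' hGm hfin] with x hx hGx hfx
    exact (ENNReal.Tendsto.sub hGx hx (Or.inl hfx.ne)).liminf_eq.symm
  have hf0fin : ∫⁻ x, f₀ x ∂μ ≠ ∞ := ne_top_of_le_ne_top hfin (lintegral_mono_ae hle₀)
  refine tendsto_order.2 ⟨fun b hb => eventually_lt_of_lt_liminf (hb.trans_le hlow), fun b hb => ?_⟩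
  obtain ⟨η, hη0, hηt, hη⟩ : ∃ η : ℝ≥0∞, 0 < η ∧ η ≠ ∞ ∧ ∫⁻ x, f₀ x ∂μ + (η + η) < b := by
    obtain ⟨r, hr1, hr2⟩ := ENNReal.lt_iff_exists_add_pos_lt.1 hb
    refine ⟨(r : ℝ≥0∞) / 2, ENNReal.half_pos (by exact_mod_cast hr1.ne'),
      (ENNReal.div_lt_top ENNReal.coe_ne_top two_ne_zero).ne, ?_⟩
    rwa [ENNReal.add_halves]
  have h0 : ∫⁻ x, G₀ x ∂μ = ∫⁻ x, f₀ x ∂μ + ∫⁻ x, (G₀ x - f₀ x) ∂μ := by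
    rw [lintegral_sub' hf₀ hf0fin hle₀]
    exact (add_tsub_cancel_of_le (lintegral_mono_ae hle₀)).symm
  have h1 : ∀ᶠ i in l, ∫⁻ x, (G₀ x - f₀ x) ∂μ < ∫⁻ x, (G i x - f i x) ∂μ + η := by
    rcases eq_or_ne (∫⁻ x, (G₀ x - f₀ x) ∂μ) 0 with hz | hz
    · rw [hz]
      exact Eventually.of_forall fun i => by positivity
    · have hBfin : ∫⁻ x, (G₀ x - f₀ x) ∂μ ≠ ∞ :=
        ne_top_of_le_ne_top hfin (lintegral_mono fun x => tsub_le_self)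
      have := eventually_lt_of_lt_liminf ((ENNReal.sub_lt_self hBfin hz hη0.ne').trans_le hlow2)
      filter_upwards [this] with i hi
      by_contra! hcon
      exact hi.not_ge (ENNReal.le_sub_of_add_le_right hηt hcon)
  have h2 : ∀ᶠ i in l, ∫⁻ x, G i x ∂μ < ∫⁻ x, G₀ x ∂μ + η :=
    hint.eventually_lt_const (ENNReal.lt_add_right hfin hη0.ne')
  filter_upwards [h1, h2, hle] with i hi1 hi2 hi3
  have hGi : ∫⁻ x, G i x ∂μ ≠ ∞ := hi2.ne_top
  have hfi : ∫⁻ x, f i x ∂μ ≠ ∞ := ne_top_of_le_ne_top hGi (lintegral_mono_ae hi3)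
  have hBi : ∫⁻ x, (G i x - f i x) ∂μ ≠ ∞ :=
    ne_top_of_le_ne_top hGi (lintegral_mono fun x => tsub_le_self)
  have h3 : ∫⁻ x, G i x ∂μ = ∫⁻ x, f i x ∂μ + ∫⁻ x, (G i x - f i x) ∂μ := by
    rw [lintegral_sub' (hf i).aemeasurable hfi hi3]
    exact (add_tsub_cancel_of_le (lintegral_mono_ae hi3)).symm
  refine lt_of_lt_of_le ?_ hη.le
  refine lt_of_add_lt_add_right (a := ∫⁻ x, (G i x - f i x) ∂μ) ?_
  calc _ = ∫⁻ x, G i x ∂μ := h3.symm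
    _ < ∫⁻ x, f₀ x ∂μ + ∫⁻ x, (G₀ x - f₀ x) ∂μ + η := h0 ▸ hi2
    _ ≤ ∫⁻ x, f₀ x ∂μ + (∫⁻ x, (G i x - f i x) ∂μ + η) + η := by gcongr
    _ = _ := by ring

section RiemannSums

variable {d : ℕ}

theorem lintegral_comp_const_smul_ne_top {V : Type*} [NormedAddCommGroup V] [NormedSpace ℝ V]
    [MeasurableSpace V] [BorelSpace V] [FiniteDimensional ℝ V] (μ : Measure V)
    [μ.IsAddHaarMeasure] {h : V → ℝ≥0∞} (hm : Measurable h) (hh : ∫⁻ x, h x ∂μ ≠ ∞) {c : ℝ}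
    (hc : c ≠ 0) : ∫⁻ x, h (c • x) ∂μ ≠ ∞ := by
  rw [← lintegral_map (μ := μ) hm (measurable_const_smul c), Measure.map_addHaar_smul μ hc,
    lintegral_smul_measure]
  exact ENNReal.mul_ne_top ENNReal.ofReal_ne_top hh

/-- Data that control the Riemann sums of `F`: near the origin `F` is below an integrable radially
nonincreasing function, and away from it `F` is below a multiple of a function `G` whose Riemann
sums converge. -/
structure RiemannControl (F G : EuclideanSpace ℝ (Fin d) → ℝ≥0∞) (K : ℝ≥0∞) (δ : ℝ)
    (ψ : ℝ → ℝ≥0∞) : Prop where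
  continuous : Continuous G
  le_one : ∀ k, G k ≤ 1
  lintegral_ne_top : ∫⁻ k, G k ≠ ∞
  tendsto : Tendsto (fun L : ℝ => (∑' z : Fin d → ℤ, G (L⁻¹ • latticeVec z))
    * ENNReal.ofReal ((L ^ d)⁻¹)) atTop (𝓝 (∫⁻ k, G k))
  measurable : Measurable F
  continuousAt : ∀ k, k ≠ 0 → ContinuousAt F k
  ne_top : K ≠ ∞
  monotone : Monotone ψ
  near : ∀ k, k ≠ 0 → ‖k‖ < δ → F k ≤ (ψ ‖k‖)⁻¹
  near_ne_top : ∫⁻ k in Metric.ball (0 : EuclideanSpace ℝ (Fin d)) δ, (ψ ‖k‖)⁻¹ ≠ ∞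
  far : ∀ k, δ ≤ ‖k‖ → F k ≤ K * G k

namespace RiemannControl

variable {F G : EuclideanSpace ℝ (Fin d) → ℝ≥0∞} {K : ℝ≥0∞} {δ : ℝ} {ψ : ℝ → ℝ≥0∞}

/-- The radial bound, cut off at `δ`. -/
noncomputable def nearBound (δ : ℝ) (ψ : ℝ → ℝ≥0∞) (k : EuclideanSpace ℝ (Fin d)) : ℝ≥0∞ :=
  (Metric.ball (0 : EuclideanSpace ℝ (Fin d)) δ).indicator (fun k => (ψ ‖k‖)⁻¹) k

theorem measurable_nearBound (h : RiemannControl F G K δ ψ) :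
    Measurable (nearBound δ ψ : EuclideanSpace ℝ (Fin d) → ℝ≥0∞) :=
  (h.monotone.measurable.comp measurable_norm).inv.indicator measurableSet_ball

theorem lintegral_nearBound_ne_top (h : RiemannControl F G K δ ψ) :
    ∫⁻ y : EuclideanSpace ℝ (Fin d), nearBound δ ψ (((d : ℝ) + 1)⁻¹ • y) ≠ ∞ := by
  refine lintegral_comp_const_smul_ne_top volume h.measurable_nearBound ?_ (by positivity)
  unfold nearBound
  rw [lintegral_indicator measurableSet_ball]
  exact h.near_ne_top

/-- The sample point of a cell may be closer to the origin than a point `y` of the cell, but not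
closer than `y / (d + 1)`, where the radial bound is evaluated instead. -/
theorem nonzeroMode_le (h : RiemannControl F G K δ ψ) {L : ℝ} (hL : 0 < L)
    (y : EuclideanSpace ℝ (Fin d)) :
    nonzeroMode F L (cellIndex L y)
      ≤ nearBound δ ψ (((d : ℝ) + 1)⁻¹ • y) + K * G (L⁻¹ • latticeVec (cellIndex L y)) := by
  unfold nonzeroMode
  split_ifs with h0
  · exact zero_le
  · set k := L⁻¹ • latticeVec (cellIndex L y) with hk
    have hkne : k ≠ 0 := by
      have h1 := one_le_norm_latticeVec h0
      intro hk0
      rw [hk, smul_eq_zero, or_iff_right (inv_pos.2 hL).ne'] at hk0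
      rw [hk0, norm_zero] at h1
      linarith
    rcases lt_or_ge ‖k‖ δ with hkd | hkd
    · refine le_trans ?_ le_self_add
      have h2 := inv_mul_norm_le hL h0
      have h3 : ‖((d : ℝ) + 1)⁻¹ • y‖ = ((d : ℝ) + 1)⁻¹ * ‖y‖ := by
        rw [norm_smul, Real.norm_of_nonneg (by positivity)]
      rw [nearBound, Set.indicator_of_mem (by simpa [h3] using h2.trans_lt hkd), h3]
      exact (h.near k hkne hkd).trans (ENNReal.inv_le_inv.2 (h.monotone h2))
    · exact (h.far k hkd).trans le_add_self

/-- Dominated convergence, for the step functions that are constant on the cells. -/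
theorem tendsto_tsum_nonzeroMode (h : RiemannControl F G K δ ψ) (hd : 1 ≤ d) :
    Tendsto (fun L : ℝ => (∑' z, nonzeroMode F L z) * ENNReal.ofReal ((L ^ d)⁻¹)) atTop
      (𝓝 (∫⁻ k, F k)) := by
  have hGL : ∀ L : ℝ, Measurable fun y : EuclideanSpace ℝ (Fin d) =>
      G (L⁻¹ • latticeVec (cellIndex L y)) := fun L =>
    (measurable_of_countable fun z : Fin d → ℤ => G (L⁻¹ • latticeVec z)).comp
      (measurable_cellIndex L)
  have hnb : Measurable fun y : EuclideanSpace ℝ (Fin d) =>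
      nearBound δ ψ (((d : ℝ) + 1)⁻¹ • y) :=
    h.measurable_nearBound.comp (measurable_const_smul _)
  have hlimF : ∀ᵐ y : EuclideanSpace ℝ (Fin d),
      Tendsto (fun L => nonzeroMode F L (cellIndex L y)) atTop (𝓝 (F y)) := by
    filter_upwards [ae_ne_zero hd] with y hy using tendsto_nonzeroMode hy (h.continuousAt y hy)
  have hlimG : ∀ y : EuclideanSpace ℝ (Fin d), Tendsto (fun L : ℝ =>
      nearBound δ ψ (((d : ℝ) + 1)⁻¹ • y) + K * G (L⁻¹ • latticeVec (cellIndex L y))) atTop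
      (𝓝 (nearBound δ ψ (((d : ℝ) + 1)⁻¹ • y) + K * G y)) := fun y =>
    tendsto_const_nhds.add (ENNReal.Tendsto.const_mul
      ((h.continuous.tendsto y).comp (tendsto_cellIndex y)) (Or.inr h.ne_top))
  have hint : ∫⁻ y : EuclideanSpace ℝ (Fin d),
      (nearBound δ ψ (((d : ℝ) + 1)⁻¹ • y) + K * G y)
      = (∫⁻ y : EuclideanSpace ℝ (Fin d), nearBound δ ψ (((d : ℝ) + 1)⁻¹ • y))
        + K * ∫⁻ y, G y := by
    rw [lintegral_add_left hnb, lintegral_const_mul _ h.continuous.measurable]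
  have hlim := tendsto_lintegral_of_tendsto_lintegral_bound (μ := volume) (l := atTop)
    (f := fun (L : ℝ) (y : EuclideanSpace ℝ (Fin d)) => nonzeroMode F L (cellIndex L y))
    (G := fun (L : ℝ) (y : EuclideanSpace ℝ (Fin d)) =>
      nearBound δ ψ (((d : ℝ) + 1)⁻¹ • y) + K * G (L⁻¹ • latticeVec (cellIndex L y)))
    (f₀ := F) (G₀ := fun y => nearBound δ ψ (((d : ℝ) + 1)⁻¹ • y) + K * G y)
    (fun L => (measurable_of_countable (nonzeroMode F L)).comp (measurable_cellIndex L))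
    (fun L => hnb.add ((hGL L).const_mul K)) h.measurable.aemeasurable
    (by
      filter_upwards [Ioi_mem_atTop 0] with L hL
      exact Eventually.of_forall fun y => h.nonzeroMode_le hL y)
    hlimF (Eventually.of_forall hlimG)
    (by
      rw [hint]
      exact ENNReal.add_ne_top.2
        ⟨h.lintegral_nearBound_ne_top, ENNReal.mul_ne_top h.ne_top h.lintegral_ne_top⟩)
    (hnb.add (h.continuous.measurable.const_mul K)).aemeasurable
    (by
      filter_upwards [hlimF] with y hy
      refine le_of_tendsto_of_tendsto hy (hlimG y) ?_
      filter_upwards [Ioi_mem_atTop 0] with L hL using h.nonzeroMode_le hL y)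
    (by
      rw [hint]
      refine (tendsto_const_nhds.add
        (ENNReal.Tendsto.const_mul h.tendsto (Or.inr h.ne_top))).congr' ?_
      filter_upwards [Ioi_mem_atTop 0] with L hL
      rw [lintegral_add_left hnb, lintegral_const_mul _ (hGL L),
        lintegral_comp_cellIndex hL fun z => G (L⁻¹ • latticeVec z)])
  refine hlim.congr' ?_
  filter_upwards [Ioi_mem_atTop 0] with L hL using lintegral_comp_cellIndex hL _

/-- No single mode other than the zero mode carries a macroscopic share of the Riemann sum: its
term is an integral over a cell, whose volume tends to zero. -/
theorem tendsto_iSup_nonzeroMode (h : RiemannControl F G K δ ψ) (hd : 1 ≤ d) :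
    Tendsto (fun L : ℝ => (⨆ z, nonzeroMode F L z) * ENNReal.ofReal ((L ^ d)⁻¹)) atTop
      (𝓝 0) := by
  have hV : Tendsto (fun L : ℝ => ENNReal.ofReal ((L ^ d)⁻¹)) atTop (𝓝 0) := by
    rw [← ENNReal.ofReal_zero]
    exact ENNReal.tendsto_ofReal (tendsto_inv_atTop_zero.comp (tendsto_pow_atTop (by omega)))
  refine ENNReal.tendsto_nhds_zero.2 fun η hη => ?_
  have hη2 : η / 2 ≠ 0 := (ENNReal.half_pos hη.ne').ne'
  -- absolute continuity of the integral of the radial bound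
  obtain ⟨τ, hτ0, hτ⟩ := exists_pos_setLIntegral_lt_of_measure_lt h.lintegral_nearBound_ne_top hη2
  have hKV : Tendsto (fun L : ℝ => K * ENNReal.ofReal ((L ^ d)⁻¹)) atTop (𝓝 0) := by
    simpa using ENNReal.Tendsto.const_mul hV (Or.inr h.ne_top)
  filter_upwards [Ioi_mem_atTop 0, hV.eventually_lt_const hτ0,
    hKV.eventually_lt_const (pos_iff_ne_zero.2 hη2)] with L hL h1 h2
  rw [ENNReal.iSup_mul]
  refine iSup_le fun z => ?_
  have hms : MeasurableSet (cellIndex L ⁻¹' {z} : Set (EuclideanSpace ℝ (Fin d))) :=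
    measurable_cellIndex L (measurableSet_singleton z)
  have hnb : Measurable fun y : EuclideanSpace ℝ (Fin d) =>
      nearBound δ ψ (((d : ℝ) + 1)⁻¹ • y) :=
    h.measurable_nearBound.comp (measurable_const_smul _)
  calc nonzeroMode F L z * ENNReal.ofReal ((L ^ d)⁻¹)
      = ∫⁻ _ in (cellIndex L ⁻¹' {z} : Set (EuclideanSpace ℝ (Fin d))), nonzeroMode F L z := by
        rw [setLIntegral_const, volume_preimage_cellIndex hL]
    _ ≤ ∫⁻ y in (cellIndex L ⁻¹' {z} : Set (EuclideanSpace ℝ (Fin d))),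
          (nearBound δ ψ (((d : ℝ) + 1)⁻¹ • y) + K) := by
        refine setLIntegral_mono (hnb.add_const K) fun y hy => ?_
        have hy' : cellIndex L y = z := hy
        rw [← hy']
        refine (h.nonzeroMode_le hL y).trans ?_
        gcongr
        exact mul_le_of_le_one_right' (h.le_one _)
    _ ≤ η / 2 + η / 2 := by
        rw [lintegral_add_left hnb, setLIntegral_const, volume_preimage_cellIndex hL]
        exact add_le_add (hτ _ (by rw [volume_preimage_cellIndex hL]; exact h1)).le h2.le
    _ = η := ENNReal.add_halves η

end RiemannControl

end RiemannSums

/-! ### The distribution of the number of excited particles -/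

/-- Nonnegative numbers `W m`, the weights of `m` particles outside the zero mode, and power sums
`s j` of the weights of these modes, related by Newton's identity. For `m = 0` the identity says
that `s 0 = 0`. -/
structure NewtonPair (W s : ℕ → ℝ) : Prop where
  nonneg : ∀ m, 0 ≤ W m
  apply_zero : W 0 = 1
  nonneg' : ∀ j, 0 ≤ s j
  newton : ∀ m : ℕ, (m : ℝ) * W m = ∑ p ∈ antidiagonal m, s p.1 * W p.2

/-- The partition function of `N` particles: the zero mode has weight one and may hold any number
of them. -/
def cumulative (W : ℕ → ℝ) (N : ℕ) : ℝ := ∑ m ∈ Finset.range (N + 1), W m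

/-- The expectation of `exp (lam n₀ / V)`, where `n₀ = N - m` is the occupation number of the zero
mode when `m` particles are excited. -/
noncomputable def zeroModeExp (W : ℕ → ℝ) (N : ℕ) (lam V : ℝ) : ℝ :=
  (∑ m ∈ Finset.range (N + 1), W m * Real.exp (lam * (N - m) / V)) / cumulative W N

namespace NewtonPair

variable {W s : ℕ → ℝ}

theorem cumulative_mono (h : NewtonPair W s) : Monotone (cumulative W) := fun a b hab =>
  Finset.sum_le_sum_of_subset_of_nonneg (Finset.range_mono (by omega)) fun m _ _ => h.nonneg m

theorem one_le_cumulative (h : NewtonPair W s) (N : ℕ) : 1 ≤ cumulative W N := by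
  have : cumulative W 0 = 1 := by simp [cumulative, h.apply_zero]
  exact this ▸ h.cumulative_mono (Nat.zero_le N)

theorem cumulative_pos (h : NewtonPair W s) (N : ℕ) : 0 < cumulative W N :=
  one_pos.trans_le (h.one_le_cumulative N)

/-- The unnormalized mean number of excited particles. -/
theorem sum_mul_eq (h : NewtonPair W s) (N : ℕ) :
    ∑ m ∈ Finset.range (N + 1), (m : ℝ) * W m
      = ∑ j ∈ Finset.range (N + 1), s j * cumulative W (N - j) := by
  simp_rw [h.newton, Finset.Nat.sum_antidiagonal_eq_sum_range_succ_mk, cumulative, Finset.mul_sum]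
  rw [Finset.sum_sigma', Finset.sum_sigma']
  refine Finset.sum_bij' (fun x _ => ⟨x.2, x.1 - x.2⟩) (fun x _ => ⟨x.1 + x.2, x.1⟩) ?_ ?_ ?_ ?_ ?_
  · rintro ⟨a, b⟩ hab
    simp only [Finset.mem_sigma, Finset.mem_range] at hab ⊢
    omega
  · rintro ⟨a, b⟩ hab
    simp only [Finset.mem_sigma, Finset.mem_range] at hab ⊢
    omega
  · rintro ⟨a, b⟩ hab
    simp only [Finset.mem_sigma, Finset.mem_range] at hab
    have : b + (a - b) = a := by omega
    simp [this]
  · rintro ⟨a, b⟩ hab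
    simp
  · rintro ⟨a, b⟩ hab
    rfl

/-- Markov's inequality for the occupation number of the zero mode, unnormalized. -/
theorem mul_cumulative_le_sum (h : NewtonPair W s) {J N : ℕ} (hJ : J ≤ N) :
    J * cumulative W (N - J) ≤ ∑ m ∈ Finset.range (N + 1), ((N : ℝ) - m) * W m := by
  rw [cumulative, Finset.mul_sum]
  refine (Finset.sum_le_sum fun m hm => ?_).trans
    (Finset.sum_le_sum_of_subset_of_nonneg (Finset.range_mono (by omega : N - J + 1 ≤ N + 1))
      fun m hm _ => ?_)
  · refine mul_le_mul_of_nonneg_right ?_ (h.nonneg m)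
    have h1 := Finset.mem_range.1 hm
    have : m + J ≤ N := by omega
    have : (m : ℝ) + J ≤ N := by exact_mod_cast this
    linarith
  · refine mul_nonneg ?_ (h.nonneg m)
    have : m ≤ N := by have := Finset.mem_range.1 hm; omega
    have : (m : ℝ) ≤ N := by exact_mod_cast this
    linarith

/-- The mean number of particles is `N`; this compares it with a lower bound on the mean occupation
of the zero mode plus a lower bound on the mean number of excited particles. -/
theorem mul_cumulative_add_le (h : NewtonPair W s) {J j₀ N : ℕ} (hJ : J ≤ N) (hj : j₀ ≤ N) :
    J * cumulative W (N - J) + (∑ j ∈ Finset.range (j₀ + 1), s j) * cumulative W (N - j₀)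
      ≤ N * cumulative W N := by
  have h1 := h.mul_cumulative_le_sum hJ
  have h2 : (∑ j ∈ Finset.range (j₀ + 1), s j) * cumulative W (N - j₀)
      ≤ ∑ m ∈ Finset.range (N + 1), (m : ℝ) * W m := by
    rw [h.sum_mul_eq, Finset.sum_mul]
    refine (Finset.sum_le_sum fun j hj' => ?_).trans
      (Finset.sum_le_sum_of_subset_of_nonneg (Finset.range_mono (by omega : j₀ + 1 ≤ N + 1))
        fun j _ _ => mul_nonneg (h.nonneg' j) (h.cumulative_pos _).le)
    refine mul_le_mul_of_nonneg_left (h.cumulative_mono ?_) (h.nonneg' j)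
    have := Finset.mem_range.1 hj'
    omega
  have h3 : (N : ℝ) * cumulative W N = ∑ m ∈ Finset.range (N + 1), ((N : ℝ) - m) * W m
      + ∑ m ∈ Finset.range (N + 1), (m : ℝ) * W m := by
    rw [← Finset.sum_add_distrib, cumulative, Finset.mul_sum]
    refine Finset.sum_congr rfl fun m _ => by ring
  linarith

/-- Log-concavity: the tail `J ↦ P(n₀ ≥ J)` decays at least geometrically. -/
theorem cumulative_div_le_pow (h : NewtonPair W s)
    (hlc : ∀ a p q, cumulative W a * cumulative W (a + p + q)
      ≤ cumulative W (a + p) * cumulative W (a + q)) {j r N : ℕ} (hjr : j * r ≤ N) :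
    cumulative W (N - j * r) / cumulative W N ≤ (cumulative W (N - j) / cumulative W N) ^ r := by
  have hpos := h.cumulative_pos N
  induction r with
  | zero => simp [hpos.ne']
  | succ r ih =>
    have hjr' : j * r + j ≤ N := by rwa [mul_add, mul_one] at hjr
    have h1 := hlc (N - (j * r + j)) j (j * r)
    rw [show N - (j * r + j) + j + j * r = N by omega,
      show N - (j * r + j) + j = N - j * r by omega,
      show N - (j * r + j) + j * r = N - j by omega] at h1
    have h2 : cumulative W (N - j * (r + 1)) / cumulative W N
        ≤ (cumulative W (N - j * r) / cumulative W N) * (cumulative W (N - j) / cumulative W N) := by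
      rw [mul_add, mul_one, div_mul_div_comm, div_le_div_iff₀ hpos (by positivity)]
      nlinarith
    rw [pow_succ]
    exact h2.trans (mul_le_mul_of_nonneg_right (ih (by omega))
      (div_nonneg (h.cumulative_pos _).le hpos.le))

theorem one_le_zeroModeExp (h : NewtonPair W s) (N : ℕ) {lam V : ℝ} (hlam : 0 ≤ lam) (hV : 0 < V) :
    1 ≤ zeroModeExp W N lam V := by
  rw [zeroModeExp, le_div_iff₀ (h.cumulative_pos N), one_mul]
  refine Finset.sum_le_sum fun m hm => le_mul_of_one_le_right (h.nonneg m) (Real.one_le_exp ?_)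
  have : m ≤ N := by have := Finset.mem_range.1 hm; omega
  have : (m : ℝ) ≤ N := by exact_mod_cast this
  exact div_nonneg (mul_nonneg hlam (by linarith)) hV.le

/-- The zero mode holds less than `δ V` particles unless at most `N - J` particles are excited. -/
theorem zeroModeExp_le (h : NewtonPair W s) {N J : ℕ} (hJ : J ≤ N) {lam V δ : ℝ} (hlam : 0 ≤ lam)
    (hV : 0 < V) (hδ : J ≤ δ * V) :
    zeroModeExp W N lam V ≤ Real.exp (lam * δ)
      + Real.exp (lam * (N / V)) * (cumulative W (N - J) / cumulative W N) := by
  have hpos := h.cumulative_pos N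
  rw [zeroModeExp, div_le_iff₀ hpos, add_mul, mul_assoc, div_mul_cancel₀ _ hpos.ne']
  calc _ ≤ ∑ m ∈ Finset.range (N + 1), (W m * Real.exp (lam * δ)
        + if m ∈ Finset.range (N - J + 1) then W m * Real.exp (lam * (N / V)) else 0) := by
        refine Finset.sum_le_sum fun m hm => ?_
        have hmN : m ≤ N := by have := Finset.mem_range.1 hm; omega
        have hWm := h.nonneg m
        split_ifs with hmJ
        · refine (mul_le_mul_of_nonneg_left (Real.exp_le_exp.2 ?_) hWm).trans
            (le_add_of_nonneg_left (by positivity))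
          rw [mul_div_assoc]
          gcongr
          simp
        · rw [add_zero]
          refine mul_le_mul_of_nonneg_left (Real.exp_le_exp.2 ?_) hWm
          rw [mul_div_assoc]
          refine mul_le_mul_of_nonneg_left ?_ hlam
          rw [div_le_iff₀ hV]
          have : N ≤ m + J := by rw [Finset.mem_range] at hmJ; omega
          have : (N : ℝ) ≤ m + J := by exact_mod_cast this
          linarith
    _ = _ := by
        rw [Finset.sum_add_distrib, ← Finset.sum_mul, ← Finset.sum_filter, ← Finset.sum_mul]
        have : (Finset.range (N + 1)).filter (· ∈ Finset.range (N - J + 1))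
            = Finset.range (N - J + 1) := by
          ext m
          simp only [Finset.mem_filter, Finset.mem_range]
          omega
        rw [this, cumulative, cumulative]
        ring

theorem zeroModeExp_le_of_lt (h : NewtonPair W s) {N : ℕ} {lam V δ : ℝ} (hlam : 0 ≤ lam)
    (hV : 0 < V) (hδ : N ≤ δ * V) : zeroModeExp W N lam V ≤ Real.exp (lam * δ) := by
  have hpos := h.cumulative_pos N
  rw [zeroModeExp, div_le_iff₀ hpos, cumulative, Finset.mul_sum]
  refine Finset.sum_le_sum fun m hm => ?_
  rw [mul_comm]
  refine mul_le_mul_of_nonneg_right (Real.exp_le_exp.2 ?_) (h.nonneg m)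
  rw [mul_div_assoc]
  refine mul_le_mul_of_nonneg_left ?_ hlam
  rw [div_le_iff₀ hV]
  have : (0 : ℝ) ≤ m := m.cast_nonneg
  linarith

end NewtonPair

/-- Below or at the critical density the zero mode is not macroscopically occupied. If `n₀` were at
least `δ V` with probability at least `η`, then by log-concavity `n₀ ≥ j₀` would be almost certain
for each fixed `j₀`, and the excited particles alone would nearly exhaust the density `ρ`. -/
theorem tendsto_zeroModeExp_one {ι : Type*} {l : Filter ι} {W s : ι → ℕ → ℝ} {V : ι → ℝ}
    {N : ι → ℕ} {ρ : ℝ} (h : ∀ᶠ i in l, NewtonPair (W i) (s i))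
    (hlc : ∀ᶠ i in l, ∀ a p q, cumulative (W i) a * cumulative (W i) (a + p + q)
      ≤ cumulative (W i) (a + p) * cumulative (W i) (a + q))
    (hρ : 0 ≤ ρ) (hV : Tendsto V l atTop) (hN : Tendsto (fun i => (N i : ℝ) / V i) l (𝓝 ρ))
    (hs : ∀ c < ρ, ∃ j₀ : ℕ, ∀ᶠ i in l, c ≤ (∑ j ∈ Finset.range (j₀ + 1), s i j) / V i)
    {lam : ℝ} (hlam : 0 ≤ lam) :
    Tendsto (fun i => zeroModeExp (W i) (N i) lam (V i)) l (𝓝 1) := by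
  -- `η` bounds the probability that the zero mode holds more than `δ V` particles
  have key : ∀ δ > 0, ∀ η > 0, ∀ᶠ i in l,
      zeroModeExp (W i) (N i) lam (V i) ≤ Real.exp (lam * δ) + Real.exp (lam * (ρ + 1)) * η := by
    intro δ hδ η hη
    obtain ⟨j₁, hj₁⟩ := hs (ρ - δ * η / 2) (by have := mul_pos hδ hη; linarith)
    -- a positive `j₀` is needed to speak of the multiples of `j₀` below `δ V`
    obtain ⟨j₀, hj₀, hj⟩ : ∃ j₀ : ℕ, 0 < j₀ ∧ ∀ᶠ i in l,
        ρ - δ * η / 2 ≤ (∑ j ∈ Finset.range (j₀ + 1), s i j) / V i := by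
      refine ⟨j₁ + 1, Nat.succ_pos _, ?_⟩
      filter_upwards [hj₁, h, hV.eventually_gt_atTop 0] with i h1 h2 h3
      refine h1.trans ?_
      gcongr
      · exact fun j _ _ => h2.nonneg' j
      · exact Nat.le_succ j₁
    -- `γ` is so small that a loss of `γ ρ V` excited particles does not affect the contradiction
    set γ : ℝ := min 1 (δ * η / (4 * (ρ + 1))) with hγ
    have hγ0 : 0 < γ := lt_min one_pos (by positivity)
    have hγ1 : γ ≤ 1 := min_le_left _ _
    have hγ2 : γ * (ρ + 1) ≤ δ * η / 4 := by
      have : γ ≤ δ * η / (4 * (ρ + 1)) := min_le_right _ _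
      rw [le_div_iff₀ (by positivity)] at this
      linarith
    let r : ι → ℕ := fun i => ⌊δ * V i / j₀⌋₊
    have hj₀' : (0 : ℝ) < j₀ := by exact_mod_cast hj₀
    have hr : Tendsto r l atTop :=
      tendsto_nat_floor_atTop.comp ((hV.const_mul_atTop hδ).atTop_div_const hj₀')
    have hpow : ∀ᶠ i in l, (1 - γ) ^ r i < η :=
      ((tendsto_pow_atTop_nhds_zero_of_lt_one (by linarith) (by linarith)).comp
        hr).eventually_lt_const hη
    have hjV : Tendsto (fun i => (j₀ : ℝ) / V i) l (𝓝 0) := tendsto_const_nhds.div_atTop hV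
    have hlim : Tendsto (fun i => (N i : ℝ) / V i + η * ((j₀ : ℝ) / V i)) l (𝓝 ρ) := by
      simpa using hN.add (hjV.const_mul η)
    have hδη := mul_pos hδ hη
    filter_upwards [h, hlc, hj, hpow, hV.eventually_gt_atTop 0, hr.eventually_ge_atTop 1,
      hlim.eventually_lt_const (by linarith : ρ < ρ + δ * η / 4),
      hN.eventually_lt_const (by linarith : ρ < ρ + 1)] with i h hlc hj hpow hV hr hlim hN1
    have hJle : ((j₀ * r i : ℕ) : ℝ) ≤ δ * V i := by
      have := Nat.floor_le (by positivity : 0 ≤ δ * V i / j₀)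
      rw [le_div_iff₀ hj₀'] at this
      push_cast
      linarith
    have hJge : δ * V i - j₀ ≤ ((j₀ * r i : ℕ) : ℝ) := by
      have := Nat.lt_floor_add_one (δ * V i / j₀)
      rw [div_lt_iff₀ hj₀'] at this
      push_cast
      change δ * V i < ((r i : ℝ) + 1) * j₀ at this
      linarith
    rcases lt_or_ge (N i) (j₀ * r i) with hlt | hge
    · have : ((N i : ℕ) : ℝ) ≤ δ * V i := le_trans (by exact_mod_cast hlt.le) hJle
      exact (h.zeroModeExp_le_of_lt hlam hV this).trans (le_add_of_nonneg_right (by positivity))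
    · refine (h.zeroModeExp_le hge hlam hV hJle).trans ?_
      have hpos := h.cumulative_pos (N i)
      have hη' : cumulative (W i) (N i - j₀ * r i) / cumulative (W i) (N i) ≤ η := by
        by_contra! hcon
        have h1 := hcon.trans_le (h.cumulative_div_le_pow hlc hge)
        have hj0N : j₀ ≤ N i := le_trans (Nat.le_mul_of_pos_right _ hr) hge
        have h2 : 1 - γ < cumulative (W i) (N i - j₀) / cumulative (W i) (N i) := by
          by_contra! hcon2
          have := pow_le_pow_left₀ (div_nonneg (h.cumulative_pos _).le hpos.le) hcon2 (r i)
          linarith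
        have h3 := h.mul_cumulative_add_le hge hj0N
        rw [← div_le_iff₀ hpos, add_div, mul_div_assoc, mul_div_assoc] at h3
        set A := cumulative (W i) (N i - j₀ * r i) / cumulative (W i) (N i) with hA
        set B := cumulative (W i) (N i - j₀) / cumulative (W i) (N i) with hB
        set σ := ∑ j ∈ Finset.range (j₀ + 1), s i j with hσ
        have hσ0 : 0 ≤ σ := Finset.sum_nonneg fun j _ => h.nonneg' j
        have h4 : (δ * V i - j₀) * η ≤ ((j₀ * r i : ℕ) : ℝ) * A := by
          calc _ ≤ ((j₀ * r i : ℕ) : ℝ) * η := by gcongr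
            _ ≤ _ := by gcongr
        have h5 : σ * (1 - γ) ≤ σ * B := by gcongr
        have h6 : (ρ - δ * η / 2) * V i ≤ σ := by rwa [le_div_iff₀ hV] at hj
        have h7 : (ρ - δ * η / 2) * V i * (1 - γ) ≤ σ * (1 - γ) := by gcongr
        have h8 : (N i : ℝ) + η * j₀ < (ρ + δ * η / 4) * V i := by
          rw [mul_div_assoc', ← add_div, div_lt_iff₀ hV] at hlim
          exact hlim
        have h9 : γ * (ρ - δ * η / 2) ≤ δ * η / 4 := by nlinarith
        have h10 : γ * (ρ - δ * η / 2) * V i ≤ δ * η / 4 * V i := by gcongr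
        nlinarith
      have hexp : lam * (N i / V i) ≤ lam * (ρ + 1) := mul_le_mul_of_nonneg_left hN1.le hlam
      exact add_le_add le_rfl (mul_le_mul (Real.exp_le_exp.2 hexp) hη'
        (div_nonneg (h.cumulative_pos _).le hpos.le) (Real.exp_pos _).le)
  refine tendsto_order.2 ⟨fun b hb => ?_, fun b hb => ?_⟩
  · filter_upwards [h, hV.eventually_gt_atTop 0] with i h hV
    exact hb.trans_le (h.one_le_zeroModeExp _ hlam hV)
  · obtain ⟨δ, hδ0, hδ⟩ : ∃ δ > 0, Real.exp (lam * δ) < (1 + b) / 2 := by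
      have h1 : Tendsto (fun δ : ℝ => Real.exp (lam * δ)) (𝓝[>] 0) (𝓝 1) := by
        have : Tendsto (fun δ : ℝ => Real.exp (lam * δ)) (𝓝 0) (𝓝 (Real.exp (lam * 0))) :=
          (by fun_prop : Continuous fun δ : ℝ => Real.exp (lam * δ)).tendsto 0
        rw [mul_zero, Real.exp_zero] at this
        exact this.mono_left nhdsWithin_le_nhds
      obtain ⟨δ, h2, h3⟩ := ((h1.eventually_lt_const (by linarith : 1 < (1 + b) / 2)).and
        self_mem_nhdsWithin).exists
      exact ⟨δ, h3, h2⟩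
    have hη : 0 < (b - 1) / 2 / Real.exp (lam * (ρ + 1)) :=
      div_pos (by linarith) (Real.exp_pos _)
    filter_upwards [key δ hδ0 _ hη] with i hi
    rw [mul_div_cancel₀ _ (Real.exp_pos _).ne'] at hi
    linarith

namespace NewtonPair

variable {W s : ℕ → ℝ}

/-- Conditioned to be at most `n`, the number of excited particles has mean at most `∑ s j`,
whatever `n` is; so by Markov's inequality half of the weight lies below `2 ∑ s j`, up to rounding,
which bounds the partial sums of `W`. -/
theorem summable (h : NewtonPair W s) (hs : Summable s) : Summable W := by
  set S := ∑' j, s j with hS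
  have hS0 : 0 ≤ S := tsum_nonneg h.nonneg'
  set M := ⌈2 * S⌉₊ with hM
  have hM2 : 2 * S ≤ M := Nat.le_ceil _
  refine summable_of_sum_range_le (c := 2 * cumulative W M) h.nonneg fun n => ?_
  have hmean : ∑ m ∈ Finset.range (n + 1), (m : ℝ) * W m ≤ S * cumulative W n := by
    rw [h.sum_mul_eq]
    calc _ ≤ ∑ j ∈ Finset.range (n + 1), s j * cumulative W n :=
          Finset.sum_le_sum fun j _ =>
            mul_le_mul_of_nonneg_left (h.cumulative_mono (Nat.sub_le n j)) (h.nonneg' j)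
      _ ≤ _ := by
          rw [← Finset.sum_mul]
          exact mul_le_mul_of_nonneg_right (hs.sum_le_tsum _ fun j _ => h.nonneg' j)
            (h.cumulative_pos n).le
  have htail : 2 * S * cumulative W n ≤ 2 * S * cumulative W M
      + ∑ m ∈ Finset.range (n + 1), (m : ℝ) * W m := by
    rw [cumulative, cumulative, Finset.mul_sum, Finset.mul_sum]
    have h1 : ∀ m ∈ Finset.range (n + 1), 2 * S * W m
        ≤ (if m ∈ Finset.range (M + 1) then 2 * S * W m else 0) + (m : ℝ) * W m := by
      intro m _
      have := h.nonneg m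
      split_ifs with hm
      · exact le_add_of_nonneg_right (by positivity)
      · rw [zero_add]
        refine mul_le_mul_of_nonneg_right (hM2.trans ?_) this
        rw [Finset.mem_range] at hm
        exact_mod_cast (by omega : M ≤ m)
    refine (Finset.sum_le_sum h1).trans ?_
    rw [Finset.sum_add_distrib, ← Finset.sum_filter]
    gcongr
    · exact fun m _ _ => mul_nonneg (by positivity) (h.nonneg m)
    · intro m hm
      exact (Finset.mem_filter.1 hm).2
  have hpos := h.cumulative_pos n
  have hle : ∑ m ∈ Finset.range n, W m ≤ cumulative W n :=
    Finset.sum_le_sum_of_subset_of_nonneg (Finset.range_mono n.le_succ) fun m _ _ => h.nonneg m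
  refine hle.trans ?_
  rcases hS0.eq_or_lt with hS1 | hS1
  · -- without excited modes the weights of `m > 0` vanish
    have hz : ∀ m ∈ Finset.range (n + 1), m ∉ Finset.range (M + 1) → W m = 0 := by
      intro m _ hm
      have hm0 : (m : ℝ) ≠ 0 := by
        rw [Finset.mem_range] at hm
        exact_mod_cast (by omega : m ≠ 0)
      have h2 := h.newton m
      have hs0 : ∀ j, s j = 0 := fun j =>
        le_antisymm (hS1 ▸ hs.le_tsum j fun j _ => h.nonneg' j) (h.nonneg' j)
      simp only [hs0, zero_mul, Finset.sum_const_zero] at h2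
      exact (mul_eq_zero.1 h2).resolve_left hm0
    have h3 : cumulative W n ≤ cumulative W M := by
      rcases le_total n M with hnM | hnM
      · exact h.cumulative_mono hnM
      · exact (Finset.sum_subset (Finset.range_mono (by omega)) hz).symm.le
    linarith [h.cumulative_pos M]
  · nlinarith

/-- The number of excited particles, if unrestricted, has mean `∑ s j` and variance `∑ j s j`. -/
theorem hasSum_sub_sq_mul (h : NewtonPair W s) (hs : Summable s)
    (hs1 : Summable fun j : ℕ => (j : ℝ) * s j) :
    HasSum (fun m : ℕ => ((m : ℝ) - ∑' j, s j) ^ 2 * W m)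
      ((∑' j : ℕ, (j : ℝ) * s j) * ∑' m, W m) := by
  have hW := h.summable hs
  set S := ∑' j, s j with hS
  set Q := ∑' j : ℕ, (j : ℝ) * s j with hQ
  set T := ∑' m, W m with hT
  have cauchy : ∀ {a b : ℕ → ℝ}, (∀ n, 0 ≤ a n) → (∀ n, 0 ≤ b n) → Summable a → Summable b →
      HasSum (fun n => ∑ p ∈ antidiagonal n, a p.1 * b p.2) ((∑' n, a n) * ∑' n, b n) := by
    intro a b ha hb hsa hsb
    have hsa' : Summable fun n => ‖a n‖ := hsa.norm
    have hsb' : Summable fun n => ‖b n‖ := hsb.norm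
    rw [tsum_mul_tsum_eq_tsum_sum_antidiagonal_of_summable_norm hsa' hsb']
    exact (summable_norm_sum_mul_antidiagonal_of_summable_norm hsa' hsb').of_norm.hasSum
  have h1 : HasSum (fun m : ℕ => (m : ℝ) * W m) (S * T) := by
    simpa only [h.newton] using cauchy h.nonneg' h.nonneg hs hW
  have hnn1 : ∀ m : ℕ, 0 ≤ (m : ℝ) * W m := fun m => mul_nonneg m.cast_nonneg (h.nonneg m)
  have hnn2 : ∀ m : ℕ, 0 ≤ (m : ℝ) * s m := fun m => mul_nonneg m.cast_nonneg (h.nonneg' m)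
  have h2 : HasSum (fun m : ℕ => (m : ℝ) ^ 2 * W m) (Q * T + S * (S * T)) := by
    have h3 := (cauchy hnn2 h.nonneg hs1 hW).add (cauchy h.nonneg' hnn1 hs h1.summable)
    rw [h1.tsum_eq] at h3
    convert h3 using 1
    ext m
    rw [pow_two, mul_assoc, h.newton, Finset.mul_sum, ← Finset.sum_add_distrib]
    refine Finset.sum_congr rfl fun p hp => ?_
    rw [← Finset.HasAntidiagonal.mem_antidiagonal.1 hp]
    push_cast
    ring
  have h4 := (h2.sub (h1.mul_left (2 * S))).add (hW.hasSum.mul_left (S ^ 2))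
  have h5 : (Q * T + S * (S * T) - 2 * S * (S * T) + S ^ 2 * T) = Q * T := by ring
  rw [← hT, h5] at h4
  refine h4.congr_fun fun m => ?_
  ring

/-- Chebyshev's inequality for the number of excited particles. -/
theorem sum_le_of_le_abs_sub (h : NewtonPair W s) (hs : Summable s)
    (hs1 : Summable fun j : ℕ => (j : ℝ) * s j) {η : ℝ} (hη : 0 < η) (B : Finset ℕ)
    (hB : ∀ m ∈ B, η ≤ |(m : ℝ) - ∑' j, s j|) :
    ∑ m ∈ B, W m ≤ (∑' j : ℕ, (j : ℝ) * s j) / η ^ 2 * ∑' m, W m := by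
  have h1 := h.hasSum_sub_sq_mul hs hs1
  have h2 : ∑ m ∈ B, η ^ 2 * W m ≤ (∑' j : ℕ, (j : ℝ) * s j) * ∑' m, W m := by
    refine le_trans (Finset.sum_le_sum fun m hm => ?_) (sum_le_hasSum B
      (fun m _ => mul_nonneg (sq_nonneg _) (h.nonneg m)) h1)
    refine mul_le_mul_of_nonneg_right ?_ (h.nonneg m)
    rw [← sq_abs ((m : ℝ) - _)]
    exact pow_le_pow_left₀ hη.le (hB m hm) 2
  rw [← Finset.mul_sum] at h2
  rw [div_mul_eq_mul_div, le_div_iff₀ (by positivity)]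
  linarith

/-- If `N` exceeds the unrestricted mean by at least `η`, restricting the number of excited
particles to at most `N` loses only a fraction of the total weight that Chebyshev's inequality
bounds. -/
theorem one_sub_mul_tsum_le (h : NewtonPair W s) (hs : Summable s)
    (hs1 : Summable fun j : ℕ => (j : ℝ) * s j) {η : ℝ} (hη : 0 < η) {N : ℕ}
    (hN : ∑' j, s j + η ≤ N) :
    (1 - (∑' j : ℕ, (j : ℝ) * s j) / η ^ 2) * ∑' m, W m ≤ cumulative W N := by
  have hW := h.summable hs
  have h1 : ∀ n, ∑ m ∈ Finset.range n, W m
      ≤ cumulative W N + (∑' j : ℕ, (j : ℝ) * s j) / η ^ 2 * ∑' m, W m := by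
    intro n
    have h2 := h.sum_le_of_le_abs_sub hs hs1 hη ((Finset.range n).filter (N < ·)) (by
      intro m hm
      have : N < m := (Finset.mem_filter.1 hm).2
      have : (N : ℝ) < m := by exact_mod_cast this
      exact le_trans (by linarith) (le_abs_self _))
    rw [← Finset.sum_filter_add_sum_filter_not (Finset.range n) (N < ·), add_comm]
    refine add_le_add (Finset.sum_le_sum_of_subset_of_nonneg (fun m hm => ?_)
      fun m _ _ => h.nonneg m) h2
    have := (Finset.mem_filter.1 hm).2
    rw [Finset.mem_range]
    omega
  have h3 := le_of_tendsto' hW.hasSum.tendsto_sum_nat h1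
  linarith

/-- Splitting according to whether the number of excited particles is within `δ V` of its
unrestricted mean; conditionally on being at most `N`, it fails to be with probability at most
`q / (1 - q)`. -/
theorem zeroModeExp_bounds (h : NewtonPair W s) (hs : Summable s)
    (hs1 : Summable fun j : ℕ => (j : ℝ) * s j) {δ V lam q : ℝ} (hδ : 0 < δ) (hV : 0 < V)
    (hlam : 0 ≤ lam) (hq : (∑' j : ℕ, (j : ℝ) * s j) / (δ * V) ^ 2 ≤ q) (hq1 : q < 1) {N : ℕ}
    (hN : ∑' j, s j + δ * V ≤ N) :
    Real.exp (lam * (N / V - (∑' j, s j) / V - δ)) * (1 - q / (1 - q)) ≤ zeroModeExp W N lam V ∧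
    zeroModeExp W N lam V ≤ Real.exp (lam * (N / V - (∑' j, s j) / V + δ))
      + Real.exp (lam * (N / V)) * (q / (1 - q)) := by
  have hη : 0 < δ * V := mul_pos hδ hV
  have hZ := h.cumulative_pos N
  set S := ∑' j, s j with hS
  set T := ∑' m, W m with hT
  have hT0 : 0 ≤ T := tsum_nonneg h.nonneg
  have hZT : (1 - q) * T ≤ cumulative W N := by
    refine le_trans ?_ (h.one_sub_mul_tsum_le hs hs1 hη hN)
    exact mul_le_mul_of_nonneg_right (by linarith) hT0
  let bad : ℕ → Prop := fun m => δ * V ≤ |(m : ℝ) - S|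
  classical
  set B := (Finset.range (N + 1)).filter bad with hBdef
  set A := (Finset.range (N + 1)).filter (fun m => ¬ bad m) with hAdef
  have hB : ∑ m ∈ B, W m ≤ q / (1 - q) * cumulative W N := by
    have h1 := h.sum_le_of_le_abs_sub hs hs1 hη B fun m hm => (Finset.mem_filter.1 hm).2
    have hq0 : 0 ≤ q := le_trans (div_nonneg
      (tsum_nonneg fun j => mul_nonneg j.cast_nonneg (h.nonneg' j)) (by positivity)) hq
    calc _ ≤ q * T := h1.trans (mul_le_mul_of_nonneg_right hq hT0)
      _ = q / (1 - q) * ((1 - q) * T) := by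
          have : 1 - q ≠ 0 := sub_ne_zero.2 hq1.ne'
          field_simp
      _ ≤ _ := mul_le_mul_of_nonneg_left hZT (div_nonneg hq0 (by linarith))
  have hAB : ∑ m ∈ A, W m + ∑ m ∈ B, W m = cumulative W N := by
    rw [add_comm, hAdef, hBdef, Finset.sum_filter_add_sum_filter_not]
    rfl
  have hA : ∀ m ∈ A, |(m : ℝ) - S| < δ * V := fun m hm => not_le.1 (Finset.mem_filter.1 hm).2
  have hnum : ∑ m ∈ Finset.range (N + 1), W m * Real.exp (lam * (N - m) / V)
      = ∑ m ∈ B, W m * Real.exp (lam * (N - m) / V)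
        + ∑ m ∈ A, W m * Real.exp (lam * (N - m) / V) := by
    rw [hAdef, hBdef, Finset.sum_filter_add_sum_filter_not]
  have hB0 : 0 ≤ ∑ m ∈ B, W m := Finset.sum_nonneg fun m _ => h.nonneg m
  constructor
  · rw [zeroModeExp, le_div_iff₀ hZ, hnum]
    have h1 : Real.exp (lam * (N / V - S / V - δ)) * ∑ m ∈ A, W m
        ≤ ∑ m ∈ A, W m * Real.exp (lam * (N - m) / V) := by
      rw [mul_comm, Finset.sum_mul]
      refine Finset.sum_le_sum fun m hm => mul_le_mul_of_nonneg_left (Real.exp_le_exp.2 ?_)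
        (h.nonneg m)
      rw [mul_div_assoc]
      refine mul_le_mul_of_nonneg_left ?_ hlam
      rw [le_div_iff₀ hV, sub_mul, sub_mul, div_mul_cancel₀ _ hV.ne', div_mul_cancel₀ _ hV.ne']
      have := (abs_lt.1 (hA m hm)).2
      linarith
    have h2 : 0 ≤ ∑ m ∈ B, W m * Real.exp (lam * (N - m) / V) :=
      Finset.sum_nonneg fun m _ => mul_nonneg (h.nonneg m) (Real.exp_pos _).le
    rw [mul_assoc]
    have h3 : (1 - q / (1 - q)) * cumulative W N ≤ ∑ m ∈ A, W m := by linarith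
    have h4 := mul_le_mul_of_nonneg_left h3 (Real.exp_pos (lam * (N / V - S / V - δ))).le
    linarith
  · rw [zeroModeExp, div_le_iff₀ hZ, hnum, add_mul, mul_assoc]
    have h1 : ∑ m ∈ A, W m * Real.exp (lam * (N - m) / V)
        ≤ Real.exp (lam * (N / V - S / V + δ)) * cumulative W N := by
      have : Real.exp (lam * (N / V - S / V + δ)) * ∑ m ∈ A, W m
          ≤ Real.exp (lam * (N / V - S / V + δ)) * cumulative W N :=
        mul_le_mul_of_nonneg_left (by linarith) (Real.exp_pos _).le
      refine le_trans ?_ this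
      rw [mul_comm, Finset.sum_mul]
      refine Finset.sum_le_sum fun m hm => mul_le_mul_of_nonneg_left (Real.exp_le_exp.2 ?_)
        (h.nonneg m)
      rw [mul_div_assoc]
      refine mul_le_mul_of_nonneg_left ?_ hlam
      rw [div_le_iff₀ hV, add_mul, sub_mul, div_mul_cancel₀ _ hV.ne', div_mul_cancel₀ _ hV.ne']
      have := (abs_lt.1 (hA m hm)).1
      linarith
    have h2 : ∑ m ∈ B, W m * Real.exp (lam * (N - m) / V)
        ≤ Real.exp (lam * (N / V)) * (q / (1 - q) * cumulative W N) := by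
      refine le_trans ?_ (mul_le_mul_of_nonneg_left hB (Real.exp_pos _).le)
      rw [mul_comm, Finset.sum_mul]
      refine Finset.sum_le_sum fun m hm => mul_le_mul_of_nonneg_left (Real.exp_le_exp.2 ?_)
        (h.nonneg m)
      rw [mul_div_assoc]
      gcongr
      simp
    linarith

end NewtonPair

/-- Above the critical density: the number of excited particles, unrestricted, has density `ρc` up
to fluctuations of lower order, so the zero mode accommodates the remaining particles. -/
theorem tendsto_zeroModeExp_of_lt {ι : Type*} {l : Filter ι} {W s : ι → ℕ → ℝ} {V : ι → ℝ}
    {N : ι → ℕ} {ρ ρc : ℝ} (h : ∀ᶠ i in l, NewtonPair (W i) (s i))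
    (hs : ∀ᶠ i in l, Summable (s i)) (hs1 : ∀ᶠ i in l, Summable fun j : ℕ => (j : ℝ) * s i j)
    (hV : Tendsto V l atTop) (hN : Tendsto (fun i => (N i : ℝ) / V i) l (𝓝 ρ))
    (hS : Tendsto (fun i => (∑' j, s i j) / V i) l (𝓝 ρc))
    (hQ : Tendsto (fun i => (∑' j : ℕ, (j : ℝ) * s i j) / V i ^ 2) l (𝓝 0))
    (hρ : ρc < ρ) {lam : ℝ} (hlam : 0 ≤ lam) :
    Tendsto (fun i => zeroModeExp (W i) (N i) lam (V i)) l
      (𝓝 (Real.exp (lam * (ρ - ρc)))) := by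
  have hNS : Tendsto (fun i => (N i : ℝ) / V i - (∑' j, s i j) / V i) l (𝓝 (ρ - ρc)) := hN.sub hS
  have hq : ∀ δ > 0, Tendsto (fun i => (∑' j : ℕ, (j : ℝ) * s i j) / (δ * V i) ^ 2) l (𝓝 0) := by
    intro δ hδ
    have := hQ.div_const (δ ^ 2)
    rw [zero_div] at this
    refine this.congr fun i => ?_
    rw [mul_pow, div_div, mul_comm]
  have hq' : ∀ δ > 0, Tendsto (fun i => (∑' j : ℕ, (j : ℝ) * s i j) / (δ * V i) ^ 2
      / (1 - (∑' j : ℕ, (j : ℝ) * s i j) / (δ * V i) ^ 2)) l (𝓝 0) := by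
    intro δ hδ
    have := (hq δ hδ).div ((hq δ hδ).const_sub 1) (by norm_num)
    rwa [zero_div] at this
  have hb : ∀ δ > 0, δ < ρ - ρc → ∀ᶠ i in l,
      Real.exp (lam * (N i / V i - (∑' j, s i j) / V i - δ))
        * (1 - (∑' j : ℕ, (j : ℝ) * s i j) / (δ * V i) ^ 2
          / (1 - (∑' j : ℕ, (j : ℝ) * s i j) / (δ * V i) ^ 2)) ≤ zeroModeExp (W i) (N i) lam (V i) ∧
      zeroModeExp (W i) (N i) lam (V i) ≤ Real.exp (lam * (N i / V i - (∑' j, s i j) / V i + δ))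
      + Real.exp (lam * (N i / V i)) * ((∑' j : ℕ, (j : ℝ) * s i j) / (δ * V i) ^ 2
          / (1 - (∑' j : ℕ, (j : ℝ) * s i j) / (δ * V i) ^ 2)) := by
    intro δ hδ hδ'
    filter_upwards [h, hs, hs1, hV.eventually_gt_atTop 0, (hq δ hδ).eventually_lt_const one_pos,
      hNS.eventually_const_lt hδ'] with i h hs hs1 hV hq hNS
    refine h.zeroModeExp_bounds hs hs1 hδ hV hlam le_rfl hq ?_
    rw [← sub_div, lt_div_iff₀ hV] at hNS
    linarith
  have hexp : Tendsto (fun δ : ℝ => Real.exp (lam * (ρ - ρc + δ))) (𝓝[>] 0)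
      (𝓝 (Real.exp (lam * (ρ - ρc)))) := by
    have : Tendsto (fun δ : ℝ => Real.exp (lam * (ρ - ρc + δ))) (𝓝 0)
        (𝓝 (Real.exp (lam * (ρ - ρc + 0)))) :=
      (by fun_prop : Continuous fun δ : ℝ => Real.exp (lam * (ρ - ρc + δ))).tendsto 0
    rw [add_zero] at this
    exact this.mono_left nhdsWithin_le_nhds
  have hexp' : Tendsto (fun δ : ℝ => Real.exp (lam * (ρ - ρc - δ))) (𝓝[>] 0)
      (𝓝 (Real.exp (lam * (ρ - ρc)))) := by
    have : Tendsto (fun δ : ℝ => Real.exp (lam * (ρ - ρc - δ))) (𝓝 0)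
        (𝓝 (Real.exp (lam * (ρ - ρc - 0)))) :=
      (by fun_prop : Continuous fun δ : ℝ => Real.exp (lam * (ρ - ρc - δ))).tendsto 0
    rw [sub_zero] at this
    exact this.mono_left nhdsWithin_le_nhds
  have hsmall : ∀ᶠ δ : ℝ in 𝓝[>] 0, 0 < δ ∧ δ < ρ - ρc := by
    filter_upwards [self_mem_nhdsWithin,
      (eventually_lt_nhds (by linarith : 0 < ρ - ρc)).filter_mono nhdsWithin_le_nhds] with δ a b
    exact ⟨a, b⟩
  refine tendsto_order.2 ⟨fun b hbl => ?_, fun b hbl => ?_⟩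
  · obtain ⟨δ, h1, h2, h3⟩ := ((hexp'.eventually_const_lt hbl).and hsmall).exists
    have h4 := (((Real.continuous_exp.tendsto _).comp ((hNS.sub_const δ).const_mul lam)).mul
      ((hq' δ h2).const_sub 1))
    simp only [sub_zero, mul_one] at h4
    filter_upwards [hb δ h2 h3, h4.eventually_const_lt h1] with i h5 h6
    exact h6.trans_le h5.1
  · obtain ⟨δ, h1, h2, h3⟩ := ((hexp.eventually_lt_const hbl).and hsmall).exists
    have h4 := ((Real.continuous_exp.tendsto _).comp ((hNS.add_const δ).const_mul lam)).add
      (((Real.continuous_exp.tendsto _).comp (hN.const_mul lam)).mul (hq' δ h2))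
    simp only [mul_zero, add_zero] at h4
    filter_upwards [hb δ h2 h3, h4.eventually_lt_const h1] with i h5 h6
    exact h5.2.trans_lt h6

/-! ### Boltzmann factors -/

theorem expNeg_eq_inv (x : ℝ≥0∞) : expNeg x = (EReal.exp (x : EReal))⁻¹ := EReal.exp_neg _

theorem expNeg_zero : expNeg 0 = 1 := by simp [expNeg]

theorem expNeg_le_one (x : ℝ≥0∞) : expNeg x ≤ 1 := by
  rw [expNeg, EReal.exp_le_one_iff]
  exact (EReal.neg_le_neg_iff.2 (EReal.coe_ennreal_nonneg x)).trans_eq neg_zero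

theorem expNeg_ne_top (x : ℝ≥0∞) : expNeg x ≠ ∞ :=
  ne_top_of_le_ne_top ENNReal.one_ne_top (expNeg_le_one x)

theorem expNeg_add (x y : ℝ≥0∞) : expNeg (x + y) = expNeg x * expNeg y := by
  rw [expNeg_eq_inv, expNeg_eq_inv, expNeg_eq_inv, EReal.coe_ennreal_add, EReal.exp_add,
    ENNReal.mul_inv]
  · left
    rw [Ne, EReal.exp_eq_zero_iff]
    exact EReal.coe_ennreal_ne_bot x
  · right
    rw [Ne, EReal.exp_eq_zero_iff]
    exact EReal.coe_ennreal_ne_bot y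

theorem expNeg_mul_natCast (x : ℝ≥0∞) (m : ℕ) : expNeg (x * m) = expNeg x ^ m := by
  induction m with
  | zero => simp [expNeg_zero]
  | succ m ih => rw [Nat.cast_succ, mul_add, mul_one, expNeg_add, ih, pow_succ]

theorem continuous_expNeg : Continuous expNeg := by
  unfold expNeg
  exact ENNReal.continuous_exp.comp (continuous_neg.comp continuous_coe_ennreal_ereal)

theorem expNeg_finsuppSum {ι : Type*} (n : ι →₀ ℕ) (e : ι → ℝ≥0∞) :
    expNeg (n.sum fun z m => e z * (m : ℝ≥0∞)) = n.prod fun z m => expNeg (e z) ^ m := by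
  classical
  rw [Finsupp.sum, Finsupp.prod]
  induction n.support using Finset.induction_on with
  | empty => simp [expNeg_zero]
  | insert a s ha ih => rw [Finset.sum_insert ha, Finset.prod_insert ha, expNeg_add, ih,
      expNeg_mul_natCast]

/-- The mean occupation number of a mode with energy `x`: the geometric series of its Boltzmann
factor. -/
noncomputable def boseFactor (x : ℝ≥0∞) : ℝ≥0∞ := expNeg x * (1 - expNeg x)⁻¹

theorem inv_exp_sub_one (x : ℝ≥0∞) : (EReal.exp (x : EReal) - 1)⁻¹ = boseFactor x := by
  rw [boseFactor, expNeg_eq_inv]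
  set y := EReal.exp (x : EReal) with hy
  have hy1 : 1 ≤ y := EReal.one_le_exp_iff.2 (EReal.coe_ennreal_nonneg x)
  have hy0 : y ≠ 0 := (one_pos.trans_le hy1).ne'
  rcases eq_or_ne y ∞ with h | h
  · simp [h]
  · rw [← ENNReal.mul_inv (Or.inl hy0) (Or.inl h), ENNReal.mul_sub (fun _ _ => h), mul_one,
      ENNReal.mul_inv_cancel hy0 h]

theorem criticalDensity_eq {d : ℕ} (ε : EuclideanSpace ℝ (Fin d) → ℝ≥0∞) :
    criticalDensity ε = ∫⁻ k, boseFactor (ε k) := by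
  simp [criticalDensity, inv_exp_sub_one]

theorem boseFactor_eq_tsum (x : ℝ≥0∞) : boseFactor x = ∑' j : ℕ, expNeg x ^ (j + 1) := by
  simp_rw [pow_succ']
  rw [ENNReal.tsum_mul_left, ENNReal.tsum_geometric, boseFactor]

theorem boseFactor_le_inv (x : ℝ≥0∞) : boseFactor x ≤ x⁻¹ := by
  rw [← inv_exp_sub_one, ENNReal.inv_le_inv]
  induction x using ENNReal.recTopCoe with
  | top => simp
  | coe r =>
    rw [show (((r : ℝ≥0∞) : EReal)) = ((r : ℝ) : EReal) from rfl, EReal.exp_coe,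
      ← ENNReal.ofReal_one, ← ENNReal.ofReal_sub _ zero_le_one, ← ENNReal.ofReal_coe_nnreal]
    exact ENNReal.ofReal_le_ofReal (by linarith [Real.add_one_le_exp (r : ℝ)])

theorem boseFactor_le_inv_one_sub (x : ℝ≥0∞) : boseFactor x ≤ (1 - expNeg x)⁻¹ :=
  mul_le_of_le_one_left' (expNeg_le_one x)

/-- The series `∑ j x^j`, for `x` the Boltzmann factor, in terms of the mean occupation number. -/
theorem tsum_mul_expNeg_pow_le (x : ℝ≥0∞) :
    ∑' j : ℕ, (j : ℝ≥0∞) * expNeg x ^ j ≤ boseFactor x * (1 + boseFactor x) := by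
  rcases eq_or_ne (expNeg x) 1 with h1 | h1
  · simp [boseFactor, h1]
  · have hlt : expNeg x < 1 := lt_of_le_of_ne (expNeg_le_one x) h1
    obtain ⟨r, hr0, hr⟩ : ∃ r : ℝ, 0 ≤ r ∧ expNeg x = ENNReal.ofReal r :=
      ⟨_, ENNReal.toReal_nonneg, (ENNReal.ofReal_toReal (expNeg_ne_top x)).symm⟩
    have hr1 : r < 1 := by
      rw [hr] at hlt
      simpa using hlt
    have hsum := hasSum_coe_mul_geometric_of_norm_lt_one (r := r)
      (by rwa [Real.norm_of_nonneg hr0])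
    have hpos : 0 < 1 - r := by linarith
    have hb : boseFactor x = ENNReal.ofReal (r / (1 - r)) := by
      rw [boseFactor, hr, ← ENNReal.ofReal_one, ← ENNReal.ofReal_sub _ hr0,
        ← ENNReal.ofReal_inv_of_pos hpos, ← ENNReal.ofReal_mul hr0, div_eq_mul_inv]
    have hterm : ∀ j : ℕ, (j : ℝ≥0∞) * expNeg x ^ j = ENNReal.ofReal (j * r ^ j) := by
      intro j
      rw [hr, ENNReal.ofReal_mul j.cast_nonneg, ENNReal.ofReal_natCast, ENNReal.ofReal_pow hr0]
    simp_rw [hterm]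
    rw [← ENNReal.ofReal_tsum_of_nonneg (fun j => by positivity) hsum.summable, hsum.tsum_eq, hb,
      ← ENNReal.ofReal_one, ← ENNReal.ofReal_add zero_le_one (by positivity),
      ← ENNReal.ofReal_mul (by positivity)]
    refine ENNReal.ofReal_le_ofReal (le_of_eq ?_)
    field_simp
    ring

/-! ### Control of the Riemann sums of the mean occupation numbers -/

section Dispersion

variable {d : ℕ} {ξ ε : EuclideanSpace ℝ (Fin d) → ℝ≥0∞}

theorem isNonnegFourierPair_expNeg (hξ : Continuous ξ) (hξ0 : ξ 0 = 0)
    (hξi : Integrable (fun x => (expNeg (ξ x)).toReal)) (hε : IsDispersionRelation ξ ε) :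
    IsNonnegFourierPair (fun x => (expNeg (ξ x)).toReal) (fun k => (expNeg (ε k)).toReal) where
  continuous := by
    refine continuous_iff_continuousAt.2 fun x => ?_
    exact (ENNReal.tendsto_toReal (expNeg_ne_top _)).comp
      (continuous_expNeg.comp hξ).continuousAt
  nonneg _ := ENNReal.toReal_nonneg
  integrable := hξi
  apply_zero := by simp [hξ0, expNeg_zero]
  nonneg' _ := ENNReal.toReal_nonneg
  fourier := hε

theorem ofReal_expNeg (x : ℝ≥0∞) : ENNReal.ofReal (expNeg x).toReal = expNeg x :=
  ENNReal.ofReal_toReal (expNeg_ne_top x)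

variable {f : EuclideanSpace ℝ (Fin d) → ℝ}

theorem continuous_expNeg_dispersion
    (h : IsNonnegFourierPair f (fun k => (expNeg (ε k)).toReal)) :
    Continuous fun k => expNeg (ε k) := by
  simpa only [Function.comp_def, ofReal_expNeg] using ENNReal.continuous_ofReal.comp h.continuous'

theorem expNeg_dispersion_zero (h : IsNonnegFourierPair f (fun k => (expNeg (ε k)).toReal)) :
    expNeg (ε 0) = 1 := by
  rw [← ofReal_expNeg, h.apply_zero', ENNReal.ofReal_one]

theorem expNeg_dispersion_lt_one (h : IsNonnegFourierPair f (fun k => (expNeg (ε k)).toReal))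
    {k : EuclideanSpace ℝ (Fin d)} (hk : k ≠ 0) : expNeg (ε k) < 1 := by
  rw [← ofReal_expNeg, ENNReal.ofReal_lt_one]
  exact h.lt_one hk

theorem lintegral_expNeg_dispersion
    (h : IsNonnegFourierPair f (fun k => (expNeg (ε k)).toReal)) :
    ∫⁻ k, expNeg (ε k) = ENNReal.ofReal (1 / ∫ x, f x) := by
  rw [← eq_one_div_of_mul_eq_one_right h.integral_mul_integral,
    ofReal_integral_eq_lintegral_ofReal h.integrable' (Eventually.of_forall h.nonneg')]
  simp only [ofReal_expNeg]

theorem continuousAt_boseFactor (h : IsNonnegFourierPair f (fun k => (expNeg (ε k)).toReal))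
    {k : EuclideanSpace ℝ (Fin d)} (hk : k ≠ 0) : ContinuousAt (fun k => boseFactor (ε k)) k := by
  have h1 := (continuous_expNeg_dispersion h).continuousAt (x := k)
  have h2 : Tendsto (fun k => (1 - expNeg (ε k))⁻¹) (𝓝 k) (𝓝 (1 - expNeg (ε k))⁻¹) :=
    (ENNReal.Tendsto.sub tendsto_const_nhds h1 (Or.inl ENNReal.one_ne_top)).inv
  refine ENNReal.Tendsto.mul h1 (Or.inr ?_) h2 (Or.inr (expNeg_ne_top _))
  rw [Ne, ENNReal.inv_eq_top, tsub_eq_zero_iff_le, not_le]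
  exact expNeg_dispersion_lt_one h hk

theorem measurable_boseFactor (h : IsNonnegFourierPair f (fun k => (expNeg (ε k)).toReal)) :
    Measurable fun k => boseFactor (ε k) := by
  have := (continuous_expNeg_dispersion h).measurable
  unfold boseFactor
  fun_prop

/-- Away from the origin the Boltzmann factors stay below one, also at infinity, by the
Riemann–Lebesgue lemma. -/
theorem exists_boseFactor_le_mul (h : IsNonnegFourierPair f (fun k => (expNeg (ε k)).toReal))
    {δ : ℝ} (hδ : 0 < δ) :
    ∃ K : ℝ≥0∞, K ≠ ∞ ∧ ∀ k, δ ≤ ‖k‖ → boseFactor (ε k) ≤ K * expNeg (ε k) := by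
  have hc := continuous_expNeg_dispersion h
  obtain ⟨q, hq1, hq⟩ : ∃ q : ℝ≥0∞, q < 1 ∧ ∀ k, δ ≤ ‖k‖ → expNeg (ε k) ≤ q := by
    have hinf : ∀ᶠ k in cocompact (EuclideanSpace ℝ (Fin d)), expNeg (ε k) < 1 / 2 := by
      have := ENNReal.tendsto_ofReal h.tendsto_cocompact
      simp only [ofReal_expNeg, ENNReal.ofReal_zero] at this
      exact this.eventually_lt_const (by simp)
    obtain ⟨A, hA, hAk⟩ := mem_cocompact.1 hinf
    have hcomp : IsCompact (A ∩ {k | δ ≤ ‖k‖}) :=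
      hA.inter_right (isClosed_le continuous_const continuous_norm)
    rcases (A ∩ {k | δ ≤ ‖k‖}).eq_empty_or_nonempty with he | hne
    · refine ⟨1 / 2, ENNReal.half_lt_self one_ne_zero ENNReal.one_ne_top, fun k hk => ?_⟩
      have hkA : k ∉ A := fun hkA => by
        have : k ∈ A ∩ {k | δ ≤ ‖k‖} := ⟨hkA, hk⟩
        rw [he] at this
        exact this.elim
      exact (hAk hkA : expNeg (ε k) < 1 / 2).le
    · obtain ⟨k₀, hk₀, hmax⟩ := hcomp.exists_isMaxOn hne hc.continuousOn
      refine ⟨max (1 / 2) (expNeg (ε k₀)), max_lt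
        (ENNReal.half_lt_self one_ne_zero ENNReal.one_ne_top)
        (expNeg_dispersion_lt_one h ?_), fun k hk => ?_⟩
      · rintro rfl
        have := hk₀.2
        simp only [Set.mem_ofPred_eq, norm_zero] at this
        linarith
      · by_cases hkA : k ∈ A
        · exact (hmax ⟨hkA, hk⟩ : expNeg (ε k) ≤ expNeg (ε k₀)).trans (le_max_right _ _)
        · exact (hAk hkA : expNeg (ε k) < 1 / 2).le.trans (le_max_left _ _)
  refine ⟨(1 - q)⁻¹, ?_, fun k hk => ?_⟩
  · rw [Ne, ENNReal.inv_eq_top, tsub_eq_zero_iff_le, not_le]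
    exact hq1
  · rw [boseFactor, mul_comm]
    gcongr
    exact hq k hk

/-- In dimension at least three the quadratic lower bound on `1 - e^{-ε}` suffices. -/
theorem exists_radial_bound_of_three_le (hd : 3 ≤ d)
    (h : IsNonnegFourierPair f (fun k => (expNeg (ε k)).toReal)) :
    ∃ δ : ℝ, 0 < δ ∧ ∃ ψ : ℝ → ℝ≥0∞, Monotone ψ ∧
      (∀ k, k ≠ 0 → ‖k‖ < δ → boseFactor (ε k) ≤ (ψ ‖k‖)⁻¹) ∧
      ∫⁻ k in Metric.ball (0 : EuclideanSpace ℝ (Fin d)) δ, (ψ ‖k‖)⁻¹ ≠ ∞ := by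
  obtain ⟨a, ha, hak⟩ := h.exists_sq_le_one_sub
  refine ⟨1, one_pos, fun r => ENNReal.ofReal (a * (max r 0) ^ 2), fun r r' hr => ?_,
    fun k _ hk1 => ?_, ?_⟩
  · refine ENNReal.ofReal_le_ofReal ?_
    gcongr
  · refine (boseFactor_le_inv_one_sub _).trans (ENNReal.inv_le_inv.2 ?_)
    simp only
    rw [max_eq_left (norm_nonneg k), ← ofReal_expNeg, ← ENNReal.ofReal_one,
      ← ENNReal.ofReal_sub _ ENNReal.toReal_nonneg]
    exact ENNReal.ofReal_le_ofReal (hak k hk1.le)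
  · have hint : IntegrableOn (fun k : EuclideanSpace ℝ (Fin d) => (a * ‖k‖ ^ 2)⁻¹)
        (Metric.ball 0 1) volume := by
      refine integrableOn_ball_of_norm_le_rpow (C := a⁻¹) (α := 2) (by simp; omega) ?_ ?_ ?_
      · rw [finrank_euclideanSpace_fin]
        exact_mod_cast (by omega : 2 < d)
      · refine Eventually.of_forall fun k => ?_
        rw [Real.norm_of_nonneg (by positivity), mul_inv, Real.rpow_neg (norm_nonneg k),
          Real.rpow_two]
      · exact Measurable.aestronglyMeasurable (by fun_prop)
    have h2 := hint.lintegral_lt_top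
    refine ne_top_of_le_ne_top h2.ne (lintegral_mono_ae ?_)
    have : Nonempty (Fin d) := ⟨⟨0, by omega⟩⟩
    filter_upwards [Measure.ae_ne (volume.restrict (Metric.ball (0 : EuclideanSpace ℝ (Fin d)) 1)) 0]
      with k hk
    have hk' : 0 < ‖k‖ := norm_pos_iff.2 hk
    rw [max_eq_left (norm_nonneg k), ENNReal.ofReal_inv_of_pos (by positivity)]

/-- The bound `ψ`, given on an interval, is extended to a monotone function on the line. -/
theorem HasIntegrableRadialLowerBound.exists_radial_bound (hd : 1 ≤ d)
    (h : HasIntegrableRadialLowerBound ε) :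
    ∃ δ : ℝ, 0 < δ ∧ ∃ ψ : ℝ → ℝ≥0∞, Monotone ψ ∧
      (∀ k, k ≠ 0 → ‖k‖ < δ → boseFactor (ε k) ≤ (ψ ‖k‖)⁻¹) ∧
      ∫⁻ k in Metric.ball (0 : EuclideanSpace ℝ (Fin d)) δ, (ψ ‖k‖)⁻¹ ≠ ∞ := by
  obtain ⟨δ, hδ, ψ, hmono, hle, hint⟩ := h
  obtain ⟨φ, hφ, heq⟩ := hmono.exists_monotone_extension (OrderBot.bddBelow _) (OrderTop.bddAbove _)
  refine ⟨δ, hδ, φ, hφ, fun k hk hkδ => ?_, ?_⟩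
  · rw [← heq ⟨norm_pos_iff.2 hk, hkδ⟩]
    exact (boseFactor_le_inv _).trans (ENNReal.inv_le_inv.2 (hle k (norm_pos_iff.2 hk) hkδ))
  · refine ne_top_of_le_ne_top hint.ne (le_of_eq (setLIntegral_congr_fun_ae measurableSet_ball ?_))
    filter_upwards [ae_ne_zero hd] with k hk hkδ
    rw [heq ⟨norm_pos_iff.2 hk, by simpa using hkδ⟩]

end Dispersion

/-! ### The canonical ensemble in a finite box -/

section Ensemble

variable {d : ℕ}

/-- The power sums of a family of weights; the value at `0` is set to `0`, which is the convention
that makes Newton's identity a convolution. -/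
noncomputable def powerSum {ι : Type*} (x : ι → ℝ≥0∞) (j : ℕ) : ℝ≥0∞ :=
  if j = 0 then 0 else ∑' i, x i ^ j

theorem powerSum_ne_top {ι : Type*} {x : ι → ℝ≥0∞} (hx : ∑' i, x i ≠ ∞) (hx1 : ∀ i, x i ≤ 1)
    (j : ℕ) : powerSum x j ≠ ∞ := by
  unfold powerSum
  split_ifs with h
  · exact ENNReal.zero_ne_top
  · exact ne_top_of_le_ne_top hx (ENNReal.tsum_le_tsum fun i => pow_le_of_le_one zero_le (hx1 i) h)

theorem newtonPair_canonicalSum {ι : Type*} {x : ι → ℝ≥0∞} (hx : ∑' i, x i ≠ ∞)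
    (hx1 : ∀ i, x i ≤ 1) :
    NewtonPair (fun m => (canonicalSum (fun i n => x i ^ n) m).toReal)
      (fun j => (powerSum x j).toReal) where
  nonneg _ := ENNReal.toReal_nonneg
  apply_zero := by simp [canonicalSum_zero]
  nonneg' _ := ENNReal.toReal_nonneg
  newton m := by
    have h := congrArg ENNReal.toReal (mul_canonicalSum x hx hx1 m)
    rw [ENNReal.toReal_mul, ENNReal.toReal_natCast, ENNReal.toReal_sum fun p _ =>
      ENNReal.mul_ne_top (powerSum_ne_top hx hx1 p.1) (canonicalSum_pow_ne_top x hx p.2)] at h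
    rw [h]
    exact Finset.sum_congr rfl fun p _ => ENNReal.toReal_mul

/-- The Boltzmann factors of the modes in the box of side `L`. -/
noncomputable def boltzmann (ε : EuclideanSpace ℝ (Fin d) → ℝ≥0∞) (L : ℝ) (z : Fin d → ℤ) : ℝ≥0∞ :=
  expNeg (ε (L⁻¹ • latticeVec z))

/-- The Boltzmann factors of the modes in the box of side `L`, without the zero mode. -/
noncomputable def excited (ε : EuclideanSpace ℝ (Fin d) → ℝ≥0∞) (L : ℝ) : (Fin d → ℤ) → ℝ≥0∞ :=
  nonzeroMode (fun k => expNeg (ε k)) L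

theorem excited_le_boltzmann (ε : EuclideanSpace ℝ (Fin d) → ℝ≥0∞) (L : ℝ) (z : Fin d → ℤ) :
    excited ε L z ≤ boltzmann ε L z := by
  unfold excited nonzeroMode boltzmann
  split_ifs
  · exact zero_le
  · exact le_rfl

theorem excited_le_one (ε : EuclideanSpace ℝ (Fin d) → ℝ≥0∞) (L : ℝ) (z : Fin d → ℤ) :
    excited ε L z ≤ 1 := (excited_le_boltzmann ε L z).trans (expNeg_le_one _)

theorem tsum_excited_ne_top {ε : EuclideanSpace ℝ (Fin d) → ℝ≥0∞} {L : ℝ}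
    (h : ∑' z, boltzmann ε L z ≠ ∞) : ∑' z, excited ε L z ≠ ∞ :=
  ne_top_of_le_ne_top h (ENNReal.tsum_le_tsum (excited_le_boltzmann ε L))

/-- The weight of `m` particles outside the zero mode, as a real number. -/
noncomputable def excitedWeight (ε : EuclideanSpace ℝ (Fin d) → ℝ≥0∞) (L : ℝ) (m : ℕ) : ℝ :=
  (canonicalSum (fun z n => excited ε L z ^ n) m).toReal

theorem occWeight_eq {N : ℕ} (ε : EuclideanSpace ℝ (Fin d) → ℝ≥0∞) (L : ℝ)
    (n : OccupationNumbers d N) :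
    occWeight ε L n = n.1.prod fun z m => boltzmann ε L z ^ m :=
  expNeg_finsuppSum n.1 fun z => ε (L⁻¹ • latticeVec z)

theorem occPartition_eq (ε : EuclideanSpace ℝ (Fin d) → ℝ≥0∞) (L : ℝ) (N : ℕ) :
    occPartition ε L N = canonicalSum (fun z m => boltzmann ε L z ^ m) N :=
  tsum_congr fun n => occWeight_eq ε L n

theorem boltzmann_zero {ε : EuclideanSpace ℝ (Fin d) → ℝ≥0∞} (h0 : expNeg (ε 0) = 1) (L : ℝ) :
    boltzmann ε L 0 = 1 := by
  rw [boltzmann, latticeVec_zero, smul_zero, h0]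

/-- A function of the occupation number of the zero mode, summed over all families. -/
theorem tsum_occWeight_mul {ε : EuclideanSpace ℝ (Fin d) → ℝ≥0∞} (h0 : expNeg (ε 0) = 1) (L : ℝ)
    (hfin : ∑' z, boltzmann ε L z ≠ ∞) (N : ℕ) {θ : ℕ → ℝ} (hθ : θ 0 = 1) (hθ0 : ∀ m, 0 ≤ θ m) :
    ∑' n : OccupationNumbers d N, occWeight ε L n * ENNReal.ofReal (θ (n.1 0))
      = ENNReal.ofReal (∑ m ∈ Finset.range (N + 1), excitedWeight ε L m * θ (N - m)) := by
  have h1 : ∀ n : OccupationNumbers d N, occWeight ε L n * ENNReal.ofReal (θ (n.1 0))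
      = n.1.prod fun z m => boltzmann ε L z ^ m * if z = 0 then ENNReal.ofReal (θ m) else 1 := by
    intro n
    rw [Finsupp.prod_mul, ← occWeight_eq, Finsupp.prod_eq_single 0]
    · simp
    · intro z _ hz
      simp [hz]
    · simp [hθ]
  have h2 := canonicalSum_eq_sum_antidiagonal
    (fun z m => boltzmann ε L z ^ m * if z = 0 then ENNReal.ofReal (θ m) else 1)
    (fun z m => excited ε L z ^ m) (by intro z; simp [hθ]) (by simp) 0
    (by intro m; simp [boltzmann_zero h0])
    (by intro m hm; simp [excited, nonzeroMode, hm])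
    (by intro z hz; ext m; simp [excited, nonzeroMode, boltzmann, hz]) N
  calc _ = canonicalSum
        (fun z m => boltzmann ε L z ^ m * if z = 0 then ENNReal.ofReal (θ m) else 1) N :=
        tsum_congr h1
    _ = _ := by
        have hW : ∀ m, 0 ≤ excitedWeight ε L m := fun _ => ENNReal.toReal_nonneg
        rw [h2, ENNReal.ofReal_sum_of_nonneg fun m _ => mul_nonneg (hW m) (hθ0 _),
          ← Finset.Nat.sum_antidiagonal_eq_sum_range_succ
            (fun m n => ENNReal.ofReal (excitedWeight ε L m * θ n)),
          ← Finset.Nat.sum_antidiagonal_swap]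
        refine Finset.sum_congr rfl fun p _ => ?_
        rw [ENNReal.ofReal_mul (hW _), excitedWeight, ENNReal.ofReal_toReal
          (canonicalSum_pow_ne_top _ (tsum_excited_ne_top hfin) _)]
        simp [boltzmann_zero h0, mul_comm]

theorem occPartition_eq_ofReal {ε : EuclideanSpace ℝ (Fin d) → ℝ≥0∞} (h0 : expNeg (ε 0) = 1)
    {L : ℝ} (hfin : ∑' z, boltzmann ε L z ≠ ∞) (N : ℕ) :
    occPartition ε L N = ENNReal.ofReal (cumulative (excitedWeight ε L) N) := by
  have h := tsum_occWeight_mul h0 L hfin N (θ := fun _ => 1) rfl (fun _ => zero_le_one)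
  simpa [cumulative, occPartition] using h

theorem newtonPair_excitedWeight {ε : EuclideanSpace ℝ (Fin d) → ℝ≥0∞} {L : ℝ}
    (hfin : ∑' z, boltzmann ε L z ≠ ∞) :
    NewtonPair (excitedWeight ε L) (fun j => (powerSum (excited ε L) j).toReal) :=
  newtonPair_canonicalSum (tsum_excited_ne_top hfin) (excited_le_one ε L)

theorem tsum_occProb {ε : EuclideanSpace ℝ (Fin d) → ℝ≥0∞} (h0 : expNeg (ε 0) = 1)
    {L : ℝ} (hfin : ∑' z, boltzmann ε L z ≠ ∞) (N : ℕ) :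
    ∑' n : OccupationNumbers d N, occProb ε L n = 1 := by
  have hpos := (newtonPair_excitedWeight hfin).cumulative_pos N
  simp only [occProb, div_eq_mul_inv]
  rw [ENNReal.tsum_mul_right]
  change occPartition ε L N * _ = 1
  rw [occPartition_eq_ofReal h0 hfin]
  exact ENNReal.mul_inv_cancel (by simpa using hpos) ENNReal.ofReal_ne_top

theorem occExpect_eq {ε : EuclideanSpace ℝ (Fin d) → ℝ≥0∞} (h0 : expNeg (ε 0) = 1)
    {L : ℝ} (hfin : ∑' z, boltzmann ε L z ≠ ∞) (N : ℕ) (lam : ℝ) :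
    occExpect ε L N (fun n => ENNReal.ofReal (Real.exp (lam * (n.1 0 : ℝ) / L ^ d)))
      = ENNReal.ofReal (zeroModeExp (excitedWeight ε L) N lam (L ^ d)) := by
  have hpos := (newtonPair_excitedWeight hfin).cumulative_pos N
  have h := tsum_occWeight_mul h0 L hfin N (θ := fun m => Real.exp (lam * m / L ^ d)) (by simp)
    (fun _ => (Real.exp_pos _).le)
  rw [zeroModeExp, ENNReal.ofReal_div_of_pos hpos, ← occPartition_eq_ofReal h0 hfin]
  have hcast : ∑ m ∈ Finset.range (N + 1), excitedWeight ε L m * Real.exp (lam * (N - m) / L ^ d)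
      = ∑ m ∈ Finset.range (N + 1), excitedWeight ε L m
        * Real.exp (lam * ((N - m : ℕ) : ℝ) / L ^ d) := by
    refine Finset.sum_congr rfl fun m hm => ?_
    rw [Nat.cast_sub (by have := Finset.mem_range.1 hm; omega)]
  rw [hcast, ← h, div_eq_mul_inv, ← ENNReal.tsum_mul_right]
  refine tsum_congr fun n => ?_
  rw [occProb, div_eq_mul_inv, mul_right_comm]

/-- Log-concavity of the partition functions, the zero mode included. -/
theorem cumulative_mul_le {ε : EuclideanSpace ℝ (Fin d) → ℝ≥0∞} (h0 : expNeg (ε 0) = 1)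
    {L : ℝ} (hfin : ∑' z, boltzmann ε L z ≠ ∞) (a p q : ℕ) :
    cumulative (excitedWeight ε L) a * cumulative (excitedWeight ε L) (a + p + q)
      ≤ cumulative (excitedWeight ε L) (a + p) * cumulative (excitedWeight ε L) (a + q) := by
  have h := isLogConcave_canonicalSum (boltzmann ε L) hfin a p q
  have hpos := (newtonPair_excitedWeight hfin).cumulative_pos
  simp only [← occPartition_eq, occPartition_eq_ofReal h0 hfin] at h
  rw [← ENNReal.ofReal_mul (hpos _).le, ← ENNReal.ofReal_mul (hpos _).le] at h
  exact (ENNReal.ofReal_le_ofReal_iff (mul_pos (hpos _) (hpos _)).le).1 h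

theorem sum_powerSum (ε : EuclideanSpace ℝ (Fin d) → ℝ≥0∞) (L : ℝ) (n : ℕ) :
    ∑ j ∈ Finset.range (n + 1), powerSum (excited ε L) j
      = ∑' z, nonzeroMode (fun k => ∑ j ∈ Finset.range n, expNeg (ε k) ^ (j + 1)) L z := by
  rw [Finset.sum_range_succ', powerSum, if_pos rfl, add_zero]
  simp only [powerSum, Nat.add_eq_zero_iff, one_ne_zero, and_false, if_false]
  rw [← Summable.tsum_finsetSum fun _ _ => ENNReal.summable]
  refine tsum_congr fun z => ?_
  unfold excited nonzeroMode
  split_ifs <;> simp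

theorem tsum_powerSum (ε : EuclideanSpace ℝ (Fin d) → ℝ≥0∞) (L : ℝ) :
    ∑' j, powerSum (excited ε L) j = ∑' z, nonzeroMode (fun k => boseFactor (ε k)) L z := by
  rw [tsum_eq_zero_add' ENNReal.summable]
  simp only [powerSum, if_true, zero_add, Nat.add_eq_zero_iff, one_ne_zero, and_false, if_false]
  rw [ENNReal.tsum_comm]
  refine tsum_congr fun z => ?_
  unfold excited nonzeroMode
  split_ifs
  · simp
  · exact (boseFactor_eq_tsum _).symm

/-- The variance of the number of excited particles, which is a sum of `b (1 + b)` over the mean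
occupation numbers `b`, is bounded through the largest of these. -/
theorem tsum_mul_powerSum_le (ε : EuclideanSpace ℝ (Fin d) → ℝ≥0∞) (L : ℝ) :
    ∑' j : ℕ, (j : ℝ≥0∞) * powerSum (excited ε L) j
      ≤ (∑' z, nonzeroMode (fun k => boseFactor (ε k)) L z)
        * (1 + ⨆ z, nonzeroMode (fun k => boseFactor (ε k)) L z) := by
  have h1 : ∀ j : ℕ, (j : ℝ≥0∞) * powerSum (excited ε L) j
      = ∑' z, (j : ℝ≥0∞) * excited ε L z ^ j := by
    intro j
    rw [ENNReal.tsum_mul_left]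
    rcases eq_or_ne j 0 with rfl | hj
    · simp
    · rw [powerSum, if_neg hj]
  simp_rw [h1]
  rw [ENNReal.tsum_comm, ← ENNReal.tsum_mul_right]
  refine ENNReal.tsum_le_tsum fun z => ?_
  by_cases hz : z = 0
  · have : ∀ j : ℕ, (j : ℝ≥0∞) * excited ε L z ^ j = 0 := by
      intro j
      rcases eq_or_ne j 0 with rfl | hj
      · simp
      · simp [excited, nonzeroMode, hz, hj]
    simp [this]
  · have h2 : excited ε L z = expNeg (ε (L⁻¹ • latticeVec z)) := by simp [excited, nonzeroMode, hz]
    have h3 : nonzeroMode (fun k => boseFactor (ε k)) L z = boseFactor (ε (L⁻¹ • latticeVec z)) := by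
      simp [nonzeroMode, hz]
    rw [h2]
    refine (tsum_mul_expNeg_pow_le _).trans ?_
    rw [← h3]
    gcongr
    exact le_iSup (nonzeroMode (fun k => boseFactor (ε k)) L) z

end Ensemble

/-! ### The infinite-volume limit -/

section Limit

variable {d : ℕ} {ξ ε : EuclideanSpace ℝ (Fin d) → ℝ≥0∞}

theorem expNegPeriodized_zero (hξ : ∀ x y : EuclideanSpace ℝ (Fin d), ‖x‖ = ‖y‖ → ξ x = ξ y)
    (L : ℝ) : expNegPeriodized ξ L 0 = ∑' z : Fin d → ℤ, expNeg (ξ (L • latticeVec z)) :=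
  tsum_congr fun z => by rw [zero_sub, hξ (-(L • latticeVec z)) (L • latticeVec z) (norm_neg _)]

/-- The Riemann sums of the Boltzmann factors are bounded through Poisson's formula. -/
theorem tsum_boltzmann_mul_le
    (h : IsNonnegFourierPair (fun x => (expNeg (ξ x)).toReal) (fun k => (expNeg (ε k)).toReal))
    (hξ : ∀ x y : EuclideanSpace ℝ (Fin d), ‖x‖ = ‖y‖ → ξ x = ξ y) {L : ℝ} (hL : 0 < L)
    (hfin : expNegPeriodized ξ L 0 ≠ ∞) :
    (∑' z, boltzmann ε L z) * ENNReal.ofReal ((L ^ d)⁻¹)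
      ≤ expNegPeriodized ξ L 0 * ENNReal.ofReal (1 / ∫ x, (expNeg (ξ x)).toReal) := by
  have hC := h.integral_pos
  rw [expNegPeriodized_zero hξ] at hfin ⊢
  rw [← ENNReal.tsum_mul_right]
  refine ENNReal.summable.tsum_le_of_sum_le fun F => ?_
  have hs := ENNReal.summable_toReal hfin
  have h1 := ENNReal.ofReal_le_ofReal (h.sum_dual_lattice_le hL hs F)
  rw [ENNReal.ofReal_sum_of_nonneg fun z _ => mul_nonneg ENNReal.toReal_nonneg (by positivity),
    ← ENNReal.tsum_toReal_eq (fun z => expNeg_ne_top _), div_eq_mul_one_div,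
    ENNReal.ofReal_mul ENNReal.toReal_nonneg, ENNReal.ofReal_toReal hfin] at h1
  refine le_trans (le_of_eq ?_) h1
  refine Finset.sum_congr rfl fun z _ => ?_
  rw [ENNReal.ofReal_mul ENNReal.toReal_nonneg, ofReal_expNeg, boltzmann]

theorem eventually_tsum_boltzmann_ne_top
    (h : IsNonnegFourierPair (fun x => (expNeg (ξ x)).toReal) (fun k => (expNeg (ε k)).toReal))
    (hξ : ∀ x y : EuclideanSpace ℝ (Fin d), ‖x‖ = ‖y‖ → ξ x = ξ y)
    (hper : Tendsto (fun L : ℝ => expNegPeriodized ξ L 0) atTop (𝓝 1)) :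
    ∀ᶠ L : ℝ in atTop, ∑' z, boltzmann ε L z ≠ ∞ := by
  filter_upwards [Ioi_mem_atTop 0, hper.eventually_lt_const ENNReal.one_lt_top] with L hL hfin htop
  have h1 := tsum_boltzmann_mul_le h hξ hL hfin.ne
  have hL' : (0 : ℝ) < (L ^ d)⁻¹ := by have : (0 : ℝ) < L := hL; positivity
  rw [htop, ENNReal.top_mul (by simpa using hL'), top_le_iff] at h1
  exact ENNReal.mul_ne_top hfin.ne ENNReal.ofReal_ne_top h1

/-- The lower bound is Fatou's lemma, the upper bound is Poisson's inequality; they agree by Fourier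
inversion at the origin. -/
theorem tendsto_tsum_boltzmann (hd : 1 ≤ d)
    (h : IsNonnegFourierPair (fun x => (expNeg (ξ x)).toReal) (fun k => (expNeg (ε k)).toReal))
    (hξ : ∀ x y : EuclideanSpace ℝ (Fin d), ‖x‖ = ‖y‖ → ξ x = ξ y)
    (hper : Tendsto (fun L : ℝ => expNegPeriodized ξ L 0) atTop (𝓝 1)) :
    Tendsto (fun L : ℝ => (∑' z, boltzmann ε L z) * ENNReal.ofReal ((L ^ d)⁻¹)) atTop
      (𝓝 (∫⁻ k, expNeg (ε k))) := by
  have hup : Tendsto (fun L : ℝ => expNegPeriodized ξ L 0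
      * ENNReal.ofReal (1 / ∫ x, (expNeg (ξ x)).toReal)) atTop (𝓝 (∫⁻ k, expNeg (ε k))) := by
    rw [lintegral_expNeg_dispersion h]
    simpa using ENNReal.Tendsto.mul_const hper (Or.inr ENNReal.ofReal_ne_top)
  refine tendsto_of_le_liminf_of_limsup_le ?_ ?_
  · refine (lintegral_le_liminf_tsum hd fun k _ =>
      (continuous_expNeg_dispersion h).continuousAt).trans (liminf_le_liminf ?_)
    refine Eventually.of_forall fun L => ?_
    exact mul_le_mul_left (ENNReal.tsum_le_tsum (excited_le_boltzmann ε L)) _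
  · rw [← hup.limsup_eq]
    refine limsup_le_limsup ?_
    filter_upwards [Ioi_mem_atTop 0, hper.eventually_lt_const ENNReal.one_lt_top] with L hL hfin
    exact tsum_boltzmann_mul_le h hξ hL hfin.ne

theorem tendsto_floor_div (hd : 1 ≤ d) (ρ : ℝ≥0) :
    Tendsto (fun L : ℝ => (⌊(ρ : ℝ) * L ^ d⌋₊ : ℝ) / L ^ d) atTop (𝓝 (ρ : ℝ)) :=
  (tendsto_nat_floor_mul_div_atTop ρ.coe_nonneg).comp (tendsto_pow_atTop (by omega))

theorem tendsto_zeroModeExp_of_le (hd : 1 ≤ d)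
    (h : IsNonnegFourierPair (fun x => (expNeg (ξ x)).toReal) (fun k => (expNeg (ε k)).toReal))
    (hfin : ∀ᶠ L : ℝ in atTop, ∑' z, boltzmann ε L z ≠ ∞) {ρ : ℝ≥0}
    (hρ : (ρ : ℝ≥0∞) ≤ criticalDensity ε) {lam : ℝ} (hlam : 0 ≤ lam) :
    Tendsto (fun L : ℝ => zeroModeExp (excitedWeight ε L) ⌊(ρ : ℝ) * L ^ d⌋₊ lam (L ^ d)) atTop
      (𝓝 1) := by
  have h0 := expNeg_dispersion_zero h
  refine tendsto_zeroModeExp_one (hfin.mono fun L hL => newtonPair_excitedWeight hL)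
    (hfin.mono fun L hL => cumulative_mul_le h0 hL) ρ.coe_nonneg (tendsto_pow_atTop (by omega))
    (tendsto_floor_div hd ρ) (fun c hc => ?_) hlam
  rcases lt_or_ge c 0 with hc0 | hc0
  · refine ⟨0, ?_⟩
    filter_upwards [Ioi_mem_atTop 0] with L hL
    have hL' : (0 : ℝ) < L := hL
    exact hc0.le.trans (div_nonneg (Finset.sum_nonneg fun _ _ => ENNReal.toReal_nonneg)
      (by positivity))
  -- a partial sum of the geometric series already has integral larger than `c`
  have hlt : ENNReal.ofReal c < ∑' j : ℕ, ∫⁻ k, expNeg (ε k) ^ (j + 1) := by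
    rw [← lintegral_tsum fun j => ((continuous_expNeg_dispersion h).measurable.pow_const _).aemeasurable]
    simp_rw [← boseFactor_eq_tsum]
    rw [← criticalDensity_eq]
    refine lt_of_lt_of_le ?_ hρ
    rwa [← ENNReal.ofReal_coe_nnreal, ENNReal.ofReal_lt_ofReal_iff_of_nonneg hc0]
  obtain ⟨n, hn⟩ := ((ENNReal.tendsto_nat_tsum _).eventually_const_lt hlt).exists
  refine ⟨n, ?_⟩
  rw [← lintegral_finsetSum _ fun j _ =>
    (continuous_expNeg_dispersion h).measurable.pow_const _] at hn
  have hcont : Continuous fun k => ∑ j ∈ Finset.range n, expNeg (ε k) ^ (j + 1) :=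
    continuous_finsetSum _ fun j _ => (ENNReal.continuous_pow _).comp
      (continuous_expNeg_dispersion h)
  have hlim := lintegral_le_liminf_tsum hd fun k _ => hcont.continuousAt (x := k)
  filter_upwards [eventually_lt_of_lt_liminf (hn.trans_le hlim), hfin,
    Ioi_mem_atTop 0] with L hL hfin hL0
  have hL0' : (0 : ℝ) < L := hL0
  have hps : ∀ j, powerSum (excited ε L) j ≠ ∞ :=
    powerSum_ne_top (tsum_excited_ne_top hfin) (excited_le_one ε L)
  rw [← sum_powerSum] at hL
  have h1 := ENNReal.toReal_mono (ENNReal.mul_ne_top (ENNReal.sum_ne_top.2 fun j _ => hps j)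
    ENNReal.ofReal_ne_top) hL.le
  rwa [ENNReal.toReal_ofReal hc0, ENNReal.toReal_mul, ENNReal.toReal_sum fun j _ => hps j,
    ENNReal.toReal_ofReal (by positivity), ← div_eq_mul_inv] at h1

theorem tendsto_zeroModeExp_of_criticalDensity_lt (hd : 1 ≤ d)
    (h : IsNonnegFourierPair (fun x => (expNeg (ξ x)).toReal) (fun k => (expNeg (ε k)).toReal))
    (hξ : ∀ x y : EuclideanSpace ℝ (Fin d), ‖x‖ = ‖y‖ → ξ x = ξ y)
    (hper : Tendsto (fun L : ℝ => expNegPeriodized ξ L 0) atTop (𝓝 1))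
    (hbd : ∃ δ : ℝ, 0 < δ ∧ ∃ ψ : ℝ → ℝ≥0∞, Monotone ψ ∧
      (∀ k, k ≠ 0 → ‖k‖ < δ → boseFactor (ε k) ≤ (ψ ‖k‖)⁻¹) ∧
      ∫⁻ k in Metric.ball (0 : EuclideanSpace ℝ (Fin d)) δ, (ψ ‖k‖)⁻¹ ≠ ∞) {ρ : ℝ≥0}
    (hρ : criticalDensity ε < ρ) {lam : ℝ} (hlam : 0 ≤ lam) :
    Tendsto (fun L : ℝ => zeroModeExp (excitedWeight ε L) ⌊(ρ : ℝ) * L ^ d⌋₊ lam (L ^ d)) atTop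
      (𝓝 (Real.exp (lam * (ρ - (criticalDensity ε).toReal)))) := by
  obtain ⟨δ, hδ, ψ, hψ, hnear, hint⟩ := hbd
  obtain ⟨K, hK, hfar⟩ := exists_boseFactor_le_mul h hδ
  have hR : RiemannControl (fun k => boseFactor (ε k)) (fun k => expNeg (ε k)) K δ ψ :=
    { continuous := continuous_expNeg_dispersion h
      le_one := fun k => expNeg_le_one _
      lintegral_ne_top := by
        rw [lintegral_expNeg_dispersion h]
        exact ENNReal.ofReal_ne_top
      tendsto := tendsto_tsum_boltzmann hd h hξ hper
      measurable := measurable_boseFactor h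
      continuousAt := fun k hk => continuousAt_boseFactor h hk
      ne_top := hK
      monotone := hψ
      near := hnear
      near_ne_top := hint
      far := hfar }
  have hρc : criticalDensity ε ≠ ∞ := hρ.ne_top
  have hfin := eventually_tsum_boltzmann_ne_top h hξ hper
  have hS := hR.tendsto_tsum_nonzeroMode hd
  rw [← criticalDensity_eq] at hS
  have hM := hR.tendsto_iSup_nonzeroMode hd
  have hV : Tendsto (fun L : ℝ => ENNReal.ofReal ((L ^ d)⁻¹)) atTop (𝓝 0) := by
    rw [← ENNReal.ofReal_zero]
    exact ENNReal.tendsto_ofReal (tendsto_inv_atTop_zero.comp (tendsto_pow_atTop (by omega)))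
  have hprod := ENNReal.Tendsto.mul hS (Or.inr (by simp)) (hV.add hM) (Or.inr hρc)
  rw [add_zero, mul_zero] at hprod
  -- the variance, divided by the square of the volume
  have hQ : Tendsto (fun L : ℝ => (∑' j : ℕ, (j : ℝ≥0∞) * powerSum (excited ε L) j)
      * (ENNReal.ofReal ((L ^ d)⁻¹) * ENNReal.ofReal ((L ^ d)⁻¹))) atTop (𝓝 0) := by
    refine tendsto_of_tendsto_of_tendsto_of_le_of_le tendsto_const_nhds hprod
      (fun L => zero_le) fun L => ?_
    refine (mul_le_mul_left (tsum_mul_powerSum_le ε L) _).trans_eq ?_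
    ring
  have hpos : ∀ᶠ L : ℝ in atTop, ENNReal.ofReal ((L ^ d)⁻¹) ≠ 0 := by
    filter_upwards [Ioi_mem_atTop 0] with L hL
    have hL' : (0 : ℝ) < L := hL
    simpa using pow_pos hL' d
  have hSfin : ∀ᶠ L : ℝ in atTop, ∑' j, powerSum (excited ε L) j ≠ ∞ := by
    filter_upwards [hS.eventually_lt_const hρc.lt_top, hpos] with L hL hp htop
    rw [← tsum_powerSum, htop, ENNReal.top_mul hp] at hL
    exact hL.ne rfl
  have hQfin : ∀ᶠ L : ℝ in atTop, ∑' j : ℕ, (j : ℝ≥0∞) * powerSum (excited ε L) j ≠ ∞ := by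
    filter_upwards [hQ.eventually_lt_const ENNReal.one_lt_top.bot_lt, hpos] with L hL hp htop
    rw [htop, ENNReal.top_mul (mul_ne_zero hp hp)] at hL
    exact not_top_lt hL
  refine tendsto_zeroModeExp_of_lt (V := fun L => L ^ d)
    (hfin.mono fun L hL => newtonPair_excitedWeight hL)
    (hSfin.mono fun L hL => ENNReal.summable_toReal hL) ?_ (tendsto_pow_atTop (by omega))
    (tendsto_floor_div hd ρ) ?_ ?_ ?_ hlam
  · filter_upwards [hQfin] with L hL
    simpa [ENNReal.toReal_mul] using ENNReal.summable_toReal hL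
  · refine ((ENNReal.tendsto_toReal hρc).comp hS).congr' ?_
    filter_upwards [hSfin, Ioi_mem_atTop 0] with L hL hL0
    have hL' : (0 : ℝ) < L := hL0
    rw [Function.comp, ← tsum_powerSum, ENNReal.toReal_mul, ENNReal.toReal_ofReal (by positivity),
      ENNReal.tsum_toReal_eq fun j => ENNReal.ne_top_of_tsum_ne_top hL j, div_eq_mul_inv]
  · refine ((ENNReal.tendsto_toReal ENNReal.zero_ne_top).comp hQ).congr' ?_
    filter_upwards [hQfin, Ioi_mem_atTop 0] with L hL hL0
    have hL' : (0 : ℝ) < L := hL0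
    rw [Function.comp, ENNReal.toReal_mul, ENNReal.toReal_mul, ENNReal.toReal_ofReal
      (by positivity),
      ENNReal.tsum_toReal_eq fun j => ENNReal.ne_top_of_tsum_ne_top hL j]
    simp only [ENNReal.toReal_mul, ENNReal.toReal_natCast]
    rw [div_eq_mul_inv, ← mul_inv, ← pow_two]
  · exact (ENNReal.toReal_lt_toReal hρc ENNReal.coe_ne_top).2 hρ

end Limit

theorem theoremA1
    (d : ℕ) (hd : 1 ≤ d)
    (ξ ε : EuclideanSpace ℝ (Fin d) → ℝ≥0∞)
    -- the one-body potential
    (hξ_cont : Continuous ξ)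
    (hξ_radial : ∀ x y : EuclideanSpace ℝ (Fin d), ‖x‖ = ‖y‖ → ξ x = ξ y)
    (hξ_zero : ξ 0 = 0)
    (hξ_int : Integrable (fun x : EuclideanSpace ℝ (Fin d) => (expNeg (ξ x)).toReal))
    -- `e^{-ξ_Λ}` is finite for large boxes and converges pointwise to `e^{-ξ}`
    (hξ_per : ∀ x : EuclideanSpace ℝ (Fin d),
      Tendsto (fun L : ℝ => expNegPeriodized ξ L x) atTop (𝓝 (expNeg (ξ x))))
    -- the Fourier transform of `e^{-ξ}` is nonnegative, equal to `C e^{-ε}`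
    (hε : IsDispersionRelation ξ ε)
    -- regularity at the origin, only when `d ≤ 2` and the critical density is finite
    (hε_reg : d ≤ 2 → criticalDensity ε < ∞ → HasIntegrableRadialLowerBound ε)
    (ρ : ℝ≥0) :
    -- for large boxes, the occupation-number measure is a probability measure
    (∀ᶠ L : ℝ in atTop, ∀ N : ℕ, ∑' n : OccupationNumbers d N, occProb ε L n = 1) ∧
    ∀ lam : ℝ, 0 ≤ lam →
      Tendsto
        (fun L : ℝ => occExpect ε L ⌊(ρ : ℝ) * L ^ d⌋₊
          (fun n => ENNReal.ofReal (Real.exp (lam * (n.1 0 : ℝ) / L ^ d))))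
        atTop (𝓝 (ENNReal.ofReal (Real.exp (lam * condensateDensity ε ρ)))) := by
  have h := isNonnegFourierPair_expNeg hξ_cont hξ_zero hξ_int hε
  have hper : Tendsto (fun L : ℝ => expNegPeriodized ξ L 0) atTop (𝓝 1) := by
    simpa [hξ_zero, expNeg_zero] using hξ_per 0
  have hfin := eventually_tsum_boltzmann_ne_top h hξ_radial hper
  have h0 := expNeg_dispersion_zero h
  refine ⟨hfin.mono fun L hL N => tsum_occProb h0 hL N, fun lam hlam => ?_⟩
  suffices H : Tendsto (fun L : ℝ => zeroModeExp (excitedWeight ε L) ⌊(ρ : ℝ) * L ^ d⌋₊ lam (L ^ d))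
      atTop (𝓝 (Real.exp (lam * condensateDensity ε ρ))) by
    refine (ENNReal.tendsto_ofReal H).congr' ?_
    filter_upwards [hfin] with L hL
    exact (occExpect_eq h0 hL _ lam).symm
  rcases le_or_gt (ρ : ℝ≥0∞) (criticalDensity ε) with hρ | hρ
  · have : condensateDensity ε ρ = 0 := by
      rw [condensateDensity, tsub_eq_zero_of_le hρ, ENNReal.toReal_zero]
    rw [this, mul_zero, Real.exp_zero]
    exact tendsto_zeroModeExp_of_le hd h hfin hρ hlam
  · have : condensateDensity ε ρ = ρ - (criticalDensity ε).toReal := by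
      rw [condensateDensity, ENNReal.toReal_sub_of_le hρ.le ENNReal.coe_ne_top, ENNReal.coe_toReal]
    rw [this]
    refine tendsto_zeroModeExp_of_criticalDensity_lt hd h hξ_radial hper ?_ hρ hlam
    rcases le_or_gt d 2 with hd2 | hd2
    · exact (hε_reg hd2 hρ.lt_top).exists_radial_bound hd
    · exact exists_radial_bound_of_three_le hd2 h
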